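/- **Setting.** Let $\mathsf{k}$ and $\mathfrak{h}$ be complex Hilbert spaces. For an interval $A\subseteq\mathbb{R}_+$ let $\mathcal{F}_A$ be the Boson Fock space over $L^2(A;\mathsf{k})$, with exponential vectors $\varepsilon(f)$, which are total and satisfy $\langle\varepsilon(f),\varepsilon(g)\rangle=\exp\langle f,g\rangle$. Write $\mathcal{F}=\mathcal{F}_{\mathbb{R}_+}$, $\mathcal{F}_{t)}=\mathcal{F}_{[0,t)}$, $\mathcal{F}_{[t}=\mathcal{F}_{[t,\infty)}$, and identify $\mathcal{F}\cong\mathcal{F}_{t)}\otimes\mathcal{F}_{[t}$ by $\varepsilon(f)\leftrightarrow\varepsilon(f|_{[0,t)})\otimes\varepsilon(f|_{[t,\infty)})$. Let $I_{t)}$ and $I_{[t}$ be the identity operators on $\mathcal{F}_{t)}$ and $\mathcal{F}_{[t}$, and let $\Gamma_t:\mathcal{F}\to\mathcal{F}_{[t}$ be the unitary operator with $\Gamma_t\varepsilon(f)=\varepsilon(f(\cdot-t))$. The CCR flow is $\sigma_t(X)=I_{t)}\otimes\Gamma_tX\Gamma_t^*$ for $t\in\mathbb{R}_+$, extended by ampliation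 to $B(\mathfrak{h}\otimes\mathcal{F})$; further, $\sigma_\infty(X):=I$ for all $X$. **Stop times.** A *quantum stop time* is a map $S$ from the Borel subsets of $[0,\infty]$ to the orthogonal projections on $\mathcal{F}$ such that $A\mapsto\langle x,S(A)y\rangle$ is a complex measure for all $x,y\in\mathcal{F}$, $S([0,\infty])=I$, $S(\{0\})\in\mathbb{C}I$ and $S([0,t])\in B(\mathcal{F}_{t)})\otimes I_{[t}$ for all $t\in(0,\infty)$. It is *finite* if $S(\{\infty\})=0$. For $t\in\mathbb{R}_+$ the quantum stop time $S+t$ is the image of the spectral measure $S$ under $s\mapsto s+t$, so that $(S+t)([0,u])$ equals $0$ if $u<t$ and $S([0,u-t])$ if $u\ge t$. Stop times act on $\mathfrak{h}\otimes\mathcal{F}$ by ampliation. **Cocycles.** Let $\mathcal{A}\subseteq B(\mathfrak{h})$ be a von Neumann algebra, let $p\in B(\mathsf{k})$ be an orthogonal projection, and let $P_{[t}\in B(\mathcal{F}_{[t})$ be its second quantisation, $P_{[t}\varepsilon(f)=\varepsilon(pf)$, where $p$ acts pointwise. A *$p$-adapted process* is a family $V=(V_t)_{t\in\mathbb{R}_+}$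 in $\mathcal{A}\,\overline{\otimes}\,B(\mathcal{F})$ (where $\overline\otimes$ is the ultraweak tensor product) with $V_t=V_{t)}\otimes P_{[t}$ and $V_{t)}\in\mathcal{A}\,\overline{\otimes}\,B(\mathcal{F}_{t)})$ for all $t$; put $\widehat V_t=V_{t)}\otimes I_{[t}$. It is a *left Markovian cocycle* if $V_{s+t}=\widehat V_s\,\sigma_s(V_t)$ for all $s,t\in\mathbb{R}_+$, and *isometric* if $V_{t)}^*V_{t)}=I$ for all $t\in\mathbb{R}_+$. **Stopping.** For $t\in(0,\infty]$, let $\pi=\{0=\pi_0<\dots<\pi_{n+1}=t\}$ run through the finite partitions of $[0,t]$, directed by refinement. For a finite quantum stop time $S$, a family $W=(W_t)_{t\in\mathbb{R}_+}$ in $B(\mathfrak{h}\otimes\mathcal{F})$ and $X\in B(\mathfrak{h}\otimes\mathcal{F})$ set, when the limits exist in the strong operator topology, $$W_{S,t}=\lim_\pi\sum_{j=1}^{n+1}W_{\pi_j}S\bigl((\pi_{j-1},\pi_j]\bigr)\quad(0<t<\infty),\qquad W_S=\lim_{t\to\infty}W_{S,t},$$ $$\sigma_S(X)=\lim_\pi\sum_{j=1}^{n+1}\sigma_{\pi_j}(X)\,S\bigl((\pi_{j-1},\pi_j]\bigr)\quad(t=\infty).$$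 **Theorem.** Let $S$ be a finite quantum stop time with $S(\{0\})=0$ and let $V$ be an isometric, strongly continuous $p$-adapted left Markovian cocycle. Then the limits defining $\widehat V_S$, $V_{S+t}$ and $\sigma_S(V_t)$ exist, and $$V_{S+t}=\widehat V_S\,\sigma_S(V_t)\qquad\text{for all }t\in\mathbb{R}_+.$$ -/

import Mathlib

open MeasureTheory Filter Topology Set
open scoped NNReal ENNReal TensorProduct InnerProductSpace ComplexOrder

noncomputable section

namespace QStop

section Hilbert

theorem denseRange_of_total {ι E : Type*} [NormedAddCommGroup E] [InnerProductSpace ℂ E]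
    (c : ι → E) (hc : (Submodule.span ℂ (range c)).topologicalClosure = ⊤) :
    DenseRange (Finsupp.linearCombination ℂ c) := by
  rw [DenseRange, ← LinearMap.coe_range, Finsupp.range_linearCombination]
  exact Submodule.dense_iff_topologicalClosure_eq_top.2 hc

theorem exists_unitary {ι E E' : Type*} [NormedAddCommGroup E] [InnerProductSpace ℂ E]
    [CompleteSpace E] [NormedAddCommGroup E'] [InnerProductSpace ℂ E'] [CompleteSpace E']
    (a : ι → E) (b : ι → E') (hab : ∀ i j, ⟪a i, a j⟫_ℂ = ⟪b i, b j⟫_ℂ)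
    (ha : (Submodule.span ℂ (range a)).topologicalClosure = ⊤)
    (hb : (Submodule.span ℂ (range b)).topologicalClosure = ⊤) :
    ∃ U : E ≃ₗᵢ[ℂ] E', ∀ i, U (a i) = b i := by
  have hn : ∀ x : ι →₀ ℂ, ‖Finsupp.linearCombination ℂ b x‖ = ‖Finsupp.linearCombination ℂ a x‖ := by
    intro x
    rw [← sq_eq_sq₀ (norm_nonneg _) (norm_nonneg _)]
    have : ⟪Finsupp.linearCombination ℂ b x, Finsupp.linearCombination ℂ b x⟫_ℂ =
        ⟪Finsupp.linearCombination ℂ a x, Finsupp.linearCombination ℂ a x⟫_ℂ := by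
      simp only [Finsupp.linearCombination_apply, Finsupp.sum, sum_inner, inner_sum,
        inner_smul_left, inner_smul_right, hab]
    rw [inner_self_eq_norm_sq_to_K, inner_self_eq_norm_sq_to_K] at this
    exact_mod_cast this
  refine ⟨(LinearEquiv.refl ℂ (ι →₀ ℂ)).extendOfIsometry _ _ (denseRange_of_total a ha)
    (denseRange_of_total b hb) hn, ?_⟩
  intro i
  have := (LinearEquiv.refl ℂ (ι →₀ ℂ)).extendOfIsometry_eq _ _ (denseRange_of_total a ha)
    (denseRange_of_total b hb) hn
    (Finsupp.single i 1)
  simpa using this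

/-- The Hilbert-space tensor product: the completion of the algebraic tensor product for the
inner product `⟪a ⊗ b, c ⊗ d⟫ = ⟪a, c⟫ ⟪b, d⟫`. -/
abbrev HilbertTensor (A B : Type*) [NormedAddCommGroup A] [InnerProductSpace ℂ A]
    [NormedAddCommGroup B] [InnerProductSpace ℂ B] : Type _ :=
  UniformSpace.Completion (A ⊗[ℂ] B)

variable {A B A' B' : Type*} [NormedAddCommGroup A] [InnerProductSpace ℂ A]
  [NormedAddCommGroup B] [InnerProductSpace ℂ B]
  [NormedAddCommGroup A'] [InnerProductSpace ℂ A']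
  [NormedAddCommGroup B'] [InnerProductSpace ℂ B']

/-- The elementary tensor `a ⊗ b`. -/
def tmul (a : A) (b : B) : HilbertTensor A B := ((a ⊗ₜ[ℂ] b : A ⊗[ℂ] B) : HilbertTensor A B)

/-- The operator `X ⊗ Y` on a Hilbert-space tensor product: the unique bounded operator such that
`(X ⊗ Y) (a ⊗ b) = X a ⊗ Y b`. -/
def opTensor (X : A →L[ℂ] A') (Y : B →L[ℂ] B') : HilbertTensor A B →L[ℂ] HilbertTensor A' B' :=
  (TensorProduct.mapL X Y).completion

theorem inner_tmul (a a' : A) (b b' : B) :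
    ⟪tmul a b, tmul a' b'⟫_ℂ = ⟪a, a'⟫_ℂ * ⟪b, b'⟫_ℂ := by
  simp [tmul, UniformSpace.Completion.inner_coe]

theorem opTensor_tmul (X : A →L[ℂ] A') (Y : B →L[ℂ] B') (a : A) (b : B) :
    opTensor X Y (tmul a b) = tmul (X a) (Y b) := by
  simp [tmul, opTensor, ContinuousLinearMap.completion_apply_coe]

theorem tmul_total {ι κ : Type*} (a : ι → A) (b : κ → B)
    (ha : (Submodule.span ℂ (range a)).topologicalClosure = ⊤)
    (hb : (Submodule.span ℂ (range b)).topologicalClosure = ⊤) :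
    (Submodule.span ℂ (range fun i : ι × κ => tmul (a i.1) (b i.2))).topologicalClosure = ⊤ := by
  set T := (Submodule.span ℂ (range fun i : ι × κ => tmul (a i.1) (b i.2))).topologicalClosure
    with hT
  have hTc : IsClosed (T : Set (HilbertTensor A B)) := Submodule.isClosed_topologicalClosure _
  let L : A →L[ℂ] B →L[ℂ] HilbertTensor A B :=
    (ContinuousLinearMap.compL ℂ B (A ⊗[ℂ] B) (HilbertTensor A B)
      UniformSpace.Completion.toComplL).comp (TensorProduct.mkL ℂ A B)
  have hL : ∀ x y, L x y = tmul x y := fun x y => rfl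
  have h1 : ∀ i y, tmul (a i) y ∈ T := by
    intro i y
    have : (Submodule.span ℂ (range b)).topologicalClosure ≤ T.comap (L (a i)).toLinearMap := by
      refine Submodule.topologicalClosure_minimal _ ?_ (hTc.preimage (L (a i)).continuous)
      rw [Submodule.span_le]
      rintro _ ⟨j, rfl⟩
      exact Submodule.le_topologicalClosure _ (Submodule.subset_span ⟨(i, j), rfl⟩)
    rw [hb] at this
    exact this (Submodule.mem_top (x := y))
  have h2 : ∀ x y, tmul x y ∈ T := by
    intro x y
    have : (Submodule.span ℂ (range a)).topologicalClosure ≤ T.comap (L.flip y).toLinearMap := by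
      refine Submodule.topologicalClosure_minimal _ ?_ (hTc.preimage (L.flip y).continuous)
      rw [Submodule.span_le]
      rintro _ ⟨j, rfl⟩
      exact h1 j y
    rw [ha] at this
    exact this (Submodule.mem_top (x := x))
  rw [eq_top_iff]
  rintro z -
  refine UniformSpace.Completion.induction_on z hTc fun w => ?_
  induction w using TensorProduct.induction_on with
  | zero => rw [UniformSpace.Completion.coe_zero]; exact T.zero_mem
  | tmul x y => exact h2 x y
  | add x y hx hy => rw [UniformSpace.Completion.coe_add]; exact T.add_mem hx hy

end Hilbert

section Fock

variable (H : Type*) [NormedAddCommGroup H] [InnerProductSpace ℂ H]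

/-- The exponential kernel `(f, g) ↦ exp ⟪f, g⟫`, as an operator-valued kernel on `ℂ`. -/
def expKernel : Matrix H H (ℂ →L[ℂ] ℂ) :=
  Matrix.of fun f g => Complex.exp ⟪f, g⟫_ℂ • ContinuousLinearMap.id ℂ ℂ

theorem expKernel_posSemidef : (expKernel H).PosSemidef := by
  have hherm : (Matrix.of fun f g : H => ⟪f, g⟫_ℂ).IsHermitian := by
    ext f g; simp [Matrix.conjTranspose_apply]
  have gram : (Matrix.of fun f g : H => ⟪f, g⟫_ℂ).PosSemidef := by
    refine ⟨hherm, fun x => ?_⟩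
    have : (x.sum fun i xi => x.sum fun j xj =>
        star xi * (Matrix.of fun f g : H => ⟪f, g⟫_ℂ) i j * xj) =
        ⟪x.sum fun i xi => xi • i, x.sum fun i xi => xi • i⟫_ℂ := by
      simp only [Finsupp.sum, sum_inner, inner_sum, inner_smul_left, inner_smul_right,
        Finset.mul_sum]
      rw [Finset.sum_comm]
      refine Finset.sum_congr rfl fun i _ => Finset.sum_congr rfl fun j _ => ?_
      simp only [Matrix.of_apply, RCLike.star_def]
      ring
    rw [this, inner_self_eq_norm_sq_to_K]
    have h : (0 : ℝ) ≤ ‖x.sum fun i xi => xi • i‖ ^ 2 := sq_nonneg _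
    have h' := Complex.zero_le_real.2 h
    rw [Complex.ofReal_pow] at h'
    exact h'
  have pow : ∀ n : ℕ, (Matrix.of fun f g : H => ⟪f, g⟫_ℂ ^ n).PosSemidef := by
    intro n
    induction n with
    | zero =>
      refine ⟨by ext; simp, fun x => ?_⟩
      have : (x.sum fun i xi => x.sum fun j xj =>
          star xi * (Matrix.of fun f g : H => ⟪f, g⟫_ℂ ^ 0) i j * xj) =
          star (x.sum fun _ xi => xi) * (x.sum fun _ xi => xi) := by
        simp [Finsupp.sum, Finset.sum_mul_sum]
      rw [this]
      exact star_mul_self_nonneg _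
    | succ n ih =>
      have e : (Matrix.of fun f g : H => ⟪f, g⟫_ℂ ^ (n + 1)) =
          (Matrix.of fun f g : H => ⟪f, g⟫_ℂ ^ n).hadamard (Matrix.of fun f g : H => ⟪f, g⟫_ℂ) := by
        ext f g; simp [pow_succ]
      rw [e]
      exact ih.hadamard gram
  have key : ∀ x : H →₀ ℂ,
      0 ≤ x.sum fun i xi => x.sum fun j xj => star xi * Complex.exp ⟪i, j⟫_ℂ * xj := by
    intro x
    have hlim : Tendsto (fun N : ℕ => ∑ n ∈ Finset.range N, ((n.factorial : ℝ)⁻¹ : ℝ) •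
        (x.sum fun i xi => x.sum fun j xj => star xi * ⟪i, j⟫_ℂ ^ n * xj)) atTop
        (𝓝 (x.sum fun i xi => x.sum fun j xj => star xi * Complex.exp ⟪i, j⟫_ℂ * xj)) := by
      have : (fun N : ℕ => ∑ n ∈ Finset.range N, ((n.factorial : ℝ)⁻¹ : ℝ) •
          (x.sum fun i xi => x.sum fun j xj => star xi * ⟪i, j⟫_ℂ ^ n * xj)) =
          fun N : ℕ => x.sum fun i xi => x.sum fun j xj =>
            star xi * (∑ n ∈ Finset.range N, ⟪i, j⟫_ℂ ^ n / n.factorial) * xj := by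
        funext N
        simp only [Finsupp.sum, Finset.smul_sum, Finset.mul_sum, Finset.sum_mul]
        rw [Finset.sum_comm]
        refine Finset.sum_congr rfl fun i _ => ?_
        rw [Finset.sum_comm]
        refine Finset.sum_congr rfl fun j _ => Finset.sum_congr rfl fun n _ => ?_
        simp only [Complex.real_smul]
        push_cast
        ring
      rw [this]
      refine tendsto_finsetSum _ fun i _ => tendsto_finsetSum _ fun j _ => ?_
      refine Tendsto.mul_const _ (Tendsto.const_mul _ ?_)
      have h := NormedSpace.expSeries_div_hasSum_exp (𝔸 := ℂ) (⟪i, j⟫_ℂ)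
      rw [← Complex.exp_eq_exp_ℂ] at h
      exact h.tendsto_sum_nat
    refine ge_of_tendsto' hlim fun N => Finset.sum_nonneg fun n _ => ?_
    exact smul_nonneg (by positivity) ((pow n).2 x)
  have herm : (expKernel H).IsHermitian := by
    have hid : ContinuousLinearMap.adjoint (ContinuousLinearMap.id ℂ ℂ) =
        ContinuousLinearMap.id ℂ ℂ := star_one (ℂ →L[ℂ] ℂ)
    ext f g
    simp [expKernel, Matrix.conjTranspose_apply, ContinuousLinearMap.star_eq_adjoint,
      ← Complex.exp_conj, hid]
  refine ((RKHS.posSemidef_tfae (K := expKernel H)).out 0 2).mpr (And.intro herm fun v => ?_)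
  have := key v
  rw [Complex.le_def] at this
  refine le_of_le_of_eq this.1 (congrArg Complex.re ?_)
  refine Finset.sum_congr rfl fun i _ => Finset.sum_congr rfl fun j _ => ?_
  simp [expKernel, ← Complex.exp_conj]
  ring

instance : Fact (expKernel H).PosSemidef := ⟨expKernel_posSemidef H⟩

/-- The Boson Fock space over `H`: the Hilbert space generated by exponential vectors `ε f`, for
`f ∈ H`, with `⟪ε f, ε g⟫ = exp ⟪f, g⟫`. It is realised as the reproducing-kernel Hilbert space of
the exponential kernel, a vector `x` being the function `f ↦ ⟪ε f, x⟫`. -/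
def Fock : Type _ := RKHS.OfKernel (expKernel H)

instance : NormedAddCommGroup (Fock H) :=
  inferInstanceAs (NormedAddCommGroup (RKHS.OfKernel (expKernel H)))

instance : InnerProductSpace ℂ (Fock H) :=
  inferInstanceAs (InnerProductSpace ℂ (RKHS.OfKernel (expKernel H)))

instance : CompleteSpace (Fock H) :=
  inferInstanceAs (CompleteSpace (RKHS.OfKernel (expKernel H)))

instance : RKHS ℂ (Fock H) H ℂ :=
  inferInstanceAs (RKHS ℂ (RKHS.OfKernel (expKernel H)) H ℂ)

variable {H}

/-- The exponential vector `ε f`. -/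
def expVec (f : H) : Fock H := RKHS.kerFun (Fock H) f (1 : ℂ)

theorem inner_expVec (f g : H) : ⟪expVec f, expVec g⟫_ℂ = Complex.exp ⟪f, g⟫_ℂ := by
  have hk : RKHS.kernel (Fock H) = expKernel H := RKHS.OfKernel.kernel_ofKernel
  rw [expVec, expVec, ← RKHS.kernel_inner, hk]
  simp [expKernel, ← Complex.exp_conj]

theorem expVec_total : (Submodule.span ℂ (range (expVec : H → Fock H))).topologicalClosure = ⊤ := by
  rw [eq_top_iff, ← RKHS.kerFun_dense (Fock H)]
  refine Submodule.topologicalClosure_mono (Submodule.span_le.2 ?_)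
  rintro _ ⟨x, v, rfl⟩
  have : RKHS.kerFun (Fock H) x v = v • expVec x := by
    rw [expVec, ← map_smul, smul_eq_mul, mul_one]
  rw [this]
  exact Submodule.smul_mem _ _ (Submodule.subset_span ⟨x, rfl⟩)

/-- The second quantisation `Γ(q)` of an orthogonal projection `q`: the orthogonal projection
with `Γ(q) (ε f) = ε (q f)` for all `f`, that is, the projection onto the closed linear span of the
exponential vectors `ε (q f)`. -/
def secondQuantProj (q : H →L[ℂ] H) : Fock H →L[ℂ] Fock H :=
  (Submodule.span ℂ (range fun f => expVec (q f))).topologicalClosure.starProjection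

theorem secondQuantProj_expVec (q : H →L[ℂ] H) (hq : ∀ f g, ⟪q f, g⟫_ℂ = ⟪q f, q g⟫_ℂ) (f : H) :
    secondQuantProj q (expVec f) = expVec (q f) := by
  refine Submodule.eq_starProjection_of_mem_of_inner_eq_zero
    (Submodule.le_topologicalClosure _ (Submodule.subset_span ⟨f, rfl⟩)) ?_
  have h : expVec f - expVec (q f) ∈ (Submodule.span ℂ (range fun f => expVec (q f)))ᗮ := by
    rw [Submodule.mem_orthogonal]
    intro w hw
    induction hw using Submodule.span_induction with
    | mem x hx =>
      obtain ⟨g, rfl⟩ := hx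
      rw [inner_sub_right, inner_expVec, inner_expVec, hq, sub_self]
    | zero => exact inner_zero_left _
    | add x y _ _ hx hy => rw [inner_add_left, hx, hy, add_zero]
    | smul a x _ hx => rw [inner_smul_left, hx, mul_zero]
  rw [← Submodule.orthogonal_closure] at h
  intro w hw
  exact inner_eq_zero_symm.1 (h w hw)

end Fock

section Intervals

/-- The space `L²(A; k)`, for `A ⊆ ℝ` and Lebesgue measure. -/
abbrev L2 (k : Type*) [NormedAddCommGroup k] (A : Set ℝ) : Type _ :=
  Lp k 2 ((volume : Measure ℝ).restrict A)

/-- The restriction `f|_A ∈ L²(A; k)` of `f ∈ L²(C; k)`, where `A ⊆ C`. -/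
def restr {k : Type*} [NormedAddCommGroup k] {A C : Set ℝ} (h : A ⊆ C) (f : L2 k C) : L2 k A :=
  ((Lp.memLp f).mono_measure (Measure.restrict_mono_set volume h)).toLp f

theorem restr_ae {k : Type*} [NormedAddCommGroup k] {A C : Set ℝ} {h : A ⊆ C} (f : L2 k C) : restr h f =ᵐ[volume.restrict A] f :=
  MemLp.coeFn_toLp _

/-- `C` is the disjoint union of the measurable sets `A` and `B`. -/
structure IsSplit (A B C : Set ℝ) : Prop where
  left : A ⊆ C
  right : B ⊆ C
  cover : C ⊆ A ∪ B
  disj : Disjoint A B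
  measLeft : MeasurableSet A
  measRight : MeasurableSet B

theorem IsSplit.ico_ici {a b : ℝ} (h : a ≤ b) : IsSplit (Ico a b) (Ici b) (Ici a) where
  left := Ico_subset_Ici_self
  right := Ici_subset_Ici.2 h
  cover := (Ico_union_Ici_eq_Ici h).ge
  disj := by
    rw [Set.disjoint_left]
    exact fun x hx hx' => not_lt_of_ge hx' hx.2
  measLeft := measurableSet_Ico
  measRight := measurableSet_Ici

theorem IsSplit.ico_ico {a b c : ℝ} (h : a ≤ b) (h' : b ≤ c) :
    IsSplit (Ico a b) (Ico b c) (Ico a c) where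
  left := Ico_subset_Ico_right h'
  right := Ico_subset_Ico_left h
  cover := (Ico_union_Ico_eq_Ico h h').ge
  disj := by
    rw [Set.disjoint_left]
    exact fun x hx hx' => not_lt_of_ge hx'.1 hx.2
  measLeft := measurableSet_Ico
  measRight := measurableSet_Ico

theorem IsSplit.exists_glue {k : Type*} [NormedAddCommGroup k] {A B C : Set ℝ}
    (h : IsSplit A B C) (f : L2 k A) (g : L2 k B) :
    ∃ F : L2 k C, restr h.left F = f ∧ restr h.right F = g := by
  have hf : MemLp (A.indicator f) 2 (volume.restrict C) :=
    ((memLp_indicator_iff_restrict h.measLeft).2 (Lp.memLp f)).restrict C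
  have hg : MemLp (B.indicator g) 2 (volume.restrict C) :=
    ((memLp_indicator_iff_restrict h.measRight).2 (Lp.memLp g)).restrict C
  have hF := hf.add hg
  have key : ∀ {D : Set ℝ} (hD : D ⊆ C), restr hD hF.toLp =ᵐ[volume.restrict D]
      A.indicator f + B.indicator g := fun hD =>
    (restr_ae _).trans (ae_mono (Measure.restrict_mono_set volume hD) hF.coeFn_toLp)
  refine ⟨hF.toLp, Lp.ext ((key h.left).trans ?_), Lp.ext ((key h.right).trans ?_)⟩
  · filter_upwards [ae_restrict_mem h.measLeft] with x hx
    simp [hx, Set.disjoint_left.1 h.disj hx]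
  · filter_upwards [ae_restrict_mem h.measRight] with x hx
    simp [hx, Set.disjoint_right.1 h.disj hx]

variable {k : Type*} [NormedAddCommGroup k] [InnerProductSpace ℂ k] {A B C : Set ℝ}

theorem IsSplit.inner_eq (h : IsSplit A B C) (f g : L2 k C) :
    ⟪f, g⟫_ℂ = ⟪restr h.left f, restr h.left g⟫_ℂ + ⟪restr h.right f, restr h.right g⟫_ℂ := by
  have hC : C = A ∪ B := h.cover.antisymm (union_subset h.left h.right)
  have hint : IntegrableOn (fun a => ⟪f a, g a⟫_ℂ) C volume := L2.integrable_inner f g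
  have e1 : ⟪restr h.left f, restr h.left g⟫_ℂ = ∫ a in A, ⟪f a, g a⟫_ℂ := by
    rw [L2.inner_def]
    refine integral_congr_ae ?_
    filter_upwards [restr_ae (h := h.left) f, restr_ae (h := h.left) g] with a ha hb
    rw [ha, hb]
  have e2 : ⟪restr h.right f, restr h.right g⟫_ℂ = ∫ a in B, ⟪f a, g a⟫_ℂ := by
    rw [L2.inner_def]
    refine integral_congr_ae ?_
    filter_upwards [restr_ae (h := h.right) f, restr_ae (h := h.right) g] with a ha hb
    rw [ha, hb]
  rw [e1, e2, L2.inner_def, ← setIntegral_union h.disj h.measRight (hint.mono_set h.left)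
    (hint.mono_set h.right), ← hC]

theorem IsSplit.total (h : IsSplit A B C) :
    (Submodule.span ℂ (range fun f : L2 k C =>
      tmul (expVec (restr h.left f)) (expVec (restr h.right f)))).topologicalClosure = ⊤ := by
  rw [← tmul_total (expVec : L2 k A → _) (expVec : L2 k B → _) expVec_total expVec_total]
  congr 2
  refine Subset.antisymm ?_ ?_
  · rintro _ ⟨f, rfl⟩
    exact ⟨(restr h.left f, restr h.right f), rfl⟩
  · rintro _ ⟨⟨f, g⟩, rfl⟩
    obtain ⟨F, rfl, rfl⟩ := h.exists_glue f g
    exact ⟨F, rfl⟩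

theorem IsSplit.exists_fock (h : IsSplit A B C) :
    ∃ U : HilbertTensor (Fock (L2 k A)) (Fock (L2 k B)) ≃ₗᵢ[ℂ] Fock (L2 k C),
      ∀ f : L2 k C, U (tmul (expVec (restr h.left f)) (expVec (restr h.right f))) = expVec f := by
  refine exists_unitary _ _ (fun f g => ?_) h.total expVec_total
  rw [inner_tmul, inner_expVec, inner_expVec, inner_expVec, ← Complex.exp_add, ← h.inner_eq]

/-- The isomorphism `F_A ⊗ F_B ≅ F_C`, `ε(f|_A) ⊗ ε(f|_B) ↔ ε(f)`, where `C = A ⊔ B`. -/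
def fockSplit (h : IsSplit A B C) :
    HilbertTensor (Fock (L2 k A)) (Fock (L2 k B)) ≃ₗᵢ[ℂ] Fock (L2 k C) :=
  h.exists_fock.choose

theorem fockSplit_apply (h : IsSplit A B C) (f : L2 k C) :
    fockSplit h (tmul (expVec (restr h.left f)) (expVec (restr h.right f))) = expVec f :=
  h.exists_fock.choose_spec f

theorem total_univ (𝔥 : Type*) [NormedAddCommGroup 𝔥] [InnerProductSpace ℂ 𝔥] :
    (Submodule.span ℂ (range (id : 𝔥 → 𝔥))).topologicalClosure = ⊤ := by
  rw [range_id, Submodule.span_univ]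
  exact top_le_iff.1 (Submodule.le_topologicalClosure _)

variable (𝔥 : Type*) [NormedAddCommGroup 𝔥] [InnerProductSpace ℂ 𝔥]

theorem IsSplit.exists_left (h : IsSplit A B C) :
    ∃ U : HilbertTensor (HilbertTensor 𝔥 (Fock (L2 k A))) (Fock (L2 k B)) ≃ₗᵢ[ℂ]
        HilbertTensor 𝔥 (Fock (L2 k C)),
      ∀ i : 𝔥 × L2 k C,
        U (tmul (tmul i.1 (expVec (restr h.left i.2))) (expVec (restr h.right i.2))) =
          tmul i.1 (expVec i.2) := by
  refine exists_unitary
    (fun i : 𝔥 × L2 k C =>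
      tmul (tmul i.1 (expVec (restr h.left i.2))) (expVec (restr h.right i.2)))
    (fun i : 𝔥 × L2 k C => tmul i.1 (expVec i.2)) (fun f g => ?_) ?_
    (tmul_total id expVec (total_univ 𝔥) expVec_total)
  · simp only [inner_tmul, inner_expVec]
    rw [h.inner_eq f.2 g.2, Complex.exp_add]
    ring
  · rw [← tmul_total _ (expVec : L2 k B → _) (tmul_total _ (expVec : L2 k A → _) (total_univ 𝔥)
      expVec_total) expVec_total]
    congr 2
    refine Subset.antisymm ?_ ?_
    · rintro _ ⟨⟨u, f⟩, rfl⟩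
      exact ⟨((u, restr h.left f), restr h.right f), rfl⟩
    · rintro _ ⟨⟨⟨u, f⟩, g⟩, rfl⟩
      obtain ⟨F, rfl, rfl⟩ := h.exists_glue f g
      exact ⟨(u, F), rfl⟩

theorem IsSplit.exists_right (h : IsSplit A B C) :
    ∃ U : HilbertTensor (Fock (L2 k A)) (HilbertTensor 𝔥 (Fock (L2 k B))) ≃ₗᵢ[ℂ]
        HilbertTensor 𝔥 (Fock (L2 k C)),
      ∀ i : 𝔥 × L2 k C,
        U (tmul (expVec (restr h.left i.2)) (tmul i.1 (expVec (restr h.right i.2)))) =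
          tmul i.1 (expVec i.2) := by
  refine exists_unitary
    (fun i : 𝔥 × L2 k C =>
      tmul (expVec (restr h.left i.2)) (tmul i.1 (expVec (restr h.right i.2))))
    (fun i : 𝔥 × L2 k C => tmul i.1 (expVec i.2)) (fun f g => ?_) ?_
    (tmul_total id expVec (total_univ 𝔥) expVec_total)
  · simp only [inner_tmul, inner_expVec]
    rw [h.inner_eq f.2 g.2, Complex.exp_add]
    ring
  · rw [← tmul_total (expVec : L2 k A → _) _ expVec_total (tmul_total _ (expVec : L2 k B → _)
      (total_univ 𝔥) expVec_total)]
    congr 2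
    refine Subset.antisymm ?_ ?_
    · rintro _ ⟨⟨u, f⟩, rfl⟩
      exact ⟨(restr h.left f, (u, restr h.right f)), rfl⟩
    · rintro _ ⟨⟨f, ⟨u, g⟩⟩, rfl⟩
      obtain ⟨F, rfl, rfl⟩ := h.exists_glue f g
      exact ⟨(u, F), rfl⟩

/-- The isomorphism `(𝔥 ⊗ F_A) ⊗ F_B ≅ 𝔥 ⊗ F_C`, `(u ⊗ ε(f|_A)) ⊗ ε(f|_B) ↔ u ⊗ ε(f)`. -/
def splitLeft (h : IsSplit A B C) :
    HilbertTensor (HilbertTensor 𝔥 (Fock (L2 k A))) (Fock (L2 k B)) ≃ₗᵢ[ℂ]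
      HilbertTensor 𝔥 (Fock (L2 k C)) :=
  (h.exists_left 𝔥).choose

theorem splitLeft_apply (h : IsSplit A B C) (u : 𝔥) (f : L2 k C) :
    splitLeft 𝔥 h (tmul (tmul u (expVec (restr h.left f))) (expVec (restr h.right f))) =
      tmul u (expVec f) :=
  (h.exists_left 𝔥).choose_spec (u, f)

/-- The isomorphism `F_A ⊗ (𝔥 ⊗ F_B) ≅ 𝔥 ⊗ F_C`, `ε(f|_A) ⊗ (u ⊗ ε(f|_B)) ↔ u ⊗ ε(f)`. -/
def splitRight (h : IsSplit A B C) :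
    HilbertTensor (Fock (L2 k A)) (HilbertTensor 𝔥 (Fock (L2 k B))) ≃ₗᵢ[ℂ]
      HilbertTensor 𝔥 (Fock (L2 k C)) :=
  (h.exists_right 𝔥).choose

theorem splitRight_apply (h : IsSplit A B C) (u : 𝔥) (f : L2 k C) :
    splitRight 𝔥 h (tmul (expVec (restr h.left f)) (tmul u (expVec (restr h.right f)))) =
      tmul u (expVec f) :=
  (h.exists_right 𝔥).choose_spec (u, f)

end Intervals

section Flow

variable {k : Type*} [NormedAddCommGroup k] [InnerProductSpace ℂ k]

theorem measurePreserving_sub (t : ℝ) : MeasurePreserving (fun s : ℝ => s - t)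
    (volume.restrict (Ici t)) (volume.restrict (Ici 0)) := by
  have h := (measurePreserving_sub_right (volume : Measure ℝ) t).restrict_preimage
    (measurableSet_Ici (a := (0 : ℝ)))
  have e : (fun s : ℝ => s - t) ⁻¹' Ici 0 = Ici t := by ext; simp
  rwa [e] at h

theorem measurePreserving_add (t : ℝ) : MeasurePreserving (fun s : ℝ => s + t)
    (volume.restrict (Ici 0)) (volume.restrict (Ici t)) := by
  have h := (measurePreserving_add_right (volume : Measure ℝ) t).restrict_preimage
    (measurableSet_Ici (a := t))
  have e : (fun s : ℝ => s + t) ⁻¹' Ici t = Ici 0 := by ext; simp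
  rwa [e] at h

/-- The right shift `(θ_t f)(s) = f(s - t)`, from `L²([0, ∞); k)` onto `L²([t, ∞); k)`. -/
def rightShift (t : ℝ) : L2 k (Ici 0) →ₗᵢ[ℂ] L2 k (Ici t) :=
  Lp.compMeasurePreservingₗᵢ ℂ (fun s => s - t) (measurePreserving_sub t)

theorem rightShift_surjective (t : ℝ) :
    Function.Surjective (rightShift t : L2 k (Ici 0) → L2 k (Ici t)) := by
  intro g
  refine ⟨Lp.compMeasurePreserving (fun s => s + t) (measurePreserving_add t) g, ?_⟩
  refine Lp.ext ?_
  have h1 := Lp.coeFn_compMeasurePreserving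
    (Lp.compMeasurePreserving (fun s => s + t) (measurePreserving_add t) g)
    (measurePreserving_sub t)
  have h2 := (measurePreserving_sub t).quasiMeasurePreserving.ae_eq_comp
    (Lp.coeFn_compMeasurePreserving g (measurePreserving_add t))
  refine h1.trans (h2.trans ?_)
  filter_upwards with s
  simp

theorem exists_fockShift (t : ℝ) : ∃ U : Fock (L2 k (Ici 0)) ≃ₗᵢ[ℂ] Fock (L2 k (Ici t)),
    ∀ f, U (expVec f) = expVec (rightShift t f) := by
  refine exists_unitary _ _ (fun f g => ?_) expVec_total ?_
  · rw [inner_expVec, inner_expVec, LinearIsometry.inner_map_map]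
  · rw [← expVec_total (H := L2 k (Ici t))]
    congr 2
    exact (rightShift_surjective t).range_comp expVec

/-- The second quantisation `Γ_t` of the right shift, as an isomorphism from the Fock space `F`
onto `F_{[t}`, with `Γ_t ε(f) = ε(θ_t f)`. -/
def fockShift (t : ℝ) : Fock (L2 k (Ici 0)) ≃ₗᵢ[ℂ] Fock (L2 k (Ici t)) :=
  (exists_fockShift t).choose

theorem fockShift_expVec (t : ℝ) (f : L2 k (Ici 0)) :
    fockShift t (expVec f) = expVec (rightShift t f) :=
  (exists_fockShift t).choose_spec f

end Flow

section StopTimes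

/-- The Boson Fock space `F` over `L²(ℝ₊; k)`. -/
abbrev FockSpace (k : Type*) [NormedAddCommGroup k] [InnerProductSpace ℂ k] : Type _ :=
  Fock (L2 k (Ici 0))

/-- The Boson Fock space `F_{t)}` over `L²([0, t); k)`. -/
abbrev FockPast (k : Type*) [NormedAddCommGroup k] [InnerProductSpace ℂ k] (t : ℝ≥0) : Type _ :=
  Fock (L2 k (Ico 0 (t : ℝ)))

/-- The Boson Fock space `F_{[t}` over `L²([t, ∞); k)`. -/
abbrev FockFuture (k : Type*) [NormedAddCommGroup k] [InnerProductSpace ℂ k] (t : ℝ≥0) : Type _ :=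
  Fock (L2 k (Ici (t : ℝ)))

theorem isSplit (t : ℝ≥0) : IsSplit (Ico 0 (t : ℝ)) (Ici (t : ℝ)) (Ici 0) :=
  IsSplit.ico_ici t.coe_nonneg

variable {k : Type*} [NormedAddCommGroup k] [InnerProductSpace ℂ k]

/-- The operator `Y ⊗ I_{[t}` on `F ≅ F_{t)} ⊗ F_{[t}`. -/
def pastOp (t : ℝ≥0) (Y : FockPast k t →L[ℂ] FockPast k t) : FockSpace k →L[ℂ] FockSpace k :=
  (fockSplit (isSplit t)).conjStarAlgEquiv (opTensor Y (ContinuousLinearMap.id ℂ _))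

variable (k) in
/-- A quantum stop time: an identity-adapted spectral measure on the Borel subsets of `[0, ∞]`,
with values in the orthogonal projections on the Fock space. (The values of `proj` on non-measurable
sets play no role.) -/
structure QuantumStopTime where
  proj : Set ℝ≥0∞ → (FockSpace k →L[ℂ] FockSpace k)
  isStarProjection : ∀ A, MeasurableSet A → IsStarProjection (proj A)
  complexMeasure : ∀ x y, ∃ μ : ComplexMeasure ℝ≥0∞,
    ∀ A, MeasurableSet A → μ A = ⟪x, proj A y⟫_ℂ
  proj_univ : proj univ = ContinuousLinearMap.id ℂ _
  adapted_zero : ∃ c : ℂ, proj {0} = c • ContinuousLinearMap.id ℂ _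
  adapted : ∀ t : ℝ≥0, 0 < t → ∃ Y : FockPast k t →L[ℂ] FockPast k t,
    proj (Iic (t : ℝ≥0∞)) = pastOp t Y

theorem fockSplit_symm_apply {A B C : Set ℝ} (h : IsSplit A B C) (f : L2 k C) :
    (fockSplit h).symm (expVec f) = tmul (expVec (restr h.left f)) (expVec (restr h.right f)) := by
  rw [LinearIsometryEquiv.symm_apply_eq, fockSplit_apply]

theorem inner_pastOp (t : ℝ≥0) (Y : FockPast k t →L[ℂ] FockPast k t) (f g : L2 k (Ici 0)) :
    ⟪expVec f, pastOp t Y (expVec g)⟫_ℂ =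
      ⟪expVec (restr (isSplit t).left f), Y (expVec (restr (isSplit t).left g))⟫_ℂ *
      Complex.exp ⟪restr (isSplit t).right f, restr (isSplit t).right g⟫_ℂ := by
  have hs := fockSplit_symm_apply (k := k) (isSplit t)
  rw [pastOp, LinearIsometryEquiv.conjStarAlgEquiv_apply_apply, hs, opTensor_tmul,
    ← LinearIsometryEquiv.inner_map_map (fockSplit (isSplit t)).symm,
    LinearIsometryEquiv.symm_apply_apply, hs, inner_tmul]
  simp [inner_expVec]

theorem ext_expVec {H : Type*} [NormedAddCommGroup H] [InnerProductSpace ℂ H]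
    {X Y : Fock H →L[ℂ] Fock H}
    (h : ∀ f g : H, ⟪expVec f, X (expVec g)⟫_ℂ = ⟪expVec f, Y (expVec g)⟫_ℂ) : X = Y := by
  have hd : Dense (Submodule.span ℂ (range (expVec : H → Fock H)) : Set (Fock H)) :=
    Submodule.dense_iff_topologicalClosure_eq_top.2 expVec_total
  refine ContinuousLinearMap.ext_on hd ?_
  rintro _ ⟨g, rfl⟩
  refine hd.eq_of_inner_right ℂ fun v hv => ?_
  induction hv using Submodule.span_induction with
  | mem x hx => obtain ⟨f, rfl⟩ := hx; exact h f g
  | zero => simp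
  | add x y _ _ hx hy => rw [inner_add_left, inner_add_left, hx, hy]
  | smul a x _ hx => rw [inner_smul_left, inner_smul_left, hx]

theorem restr_restr {k : Type*} [NormedAddCommGroup k] {A B C : Set ℝ} (h : A ⊆ B) (h' : B ⊆ C)
    (f : L2 k C) : restr h (restr h' f) = restr (h.trans h') f :=
  have h1 : restr h' f =ᵐ[volume.restrict A] f :=
    ae_mono (Measure.restrict_mono_set volume h) (restr_ae f)
  Lp.ext ((restr_ae _).trans (h1.trans (restr_ae f).symm))

/-- `B(F_{s)}) ⊗ I_{[s} ⊆ B(F_{t)}) ⊗ I_{[t}` for `s ≤ t`. -/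
theorem pastOp_mono {s t : ℝ≥0} (hst : s ≤ t) (Y : FockPast k s →L[ℂ] FockPast k s) :
    ∃ Z : FockPast k t →L[ℂ] FockPast k t, pastOp s Y = pastOp t Z := by
  have h := IsSplit.ico_ico s.coe_nonneg (NNReal.coe_le_coe.2 hst)
  have h' := IsSplit.ico_ici (NNReal.coe_le_coe.2 hst)
  refine ⟨(fockSplit h).conjStarAlgEquiv (opTensor Y (ContinuousLinearMap.id ℂ _)), ?_⟩
  have hs := fockSplit_symm_apply (k := k) h
  refine ext_expVec fun f g => ?_
  rw [inner_pastOp, inner_pastOp, LinearIsometryEquiv.conjStarAlgEquiv_apply_apply, hs,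
    opTensor_tmul, ← LinearIsometryEquiv.inner_map_map (fockSplit h).symm,
    LinearIsometryEquiv.symm_apply_apply, hs, inner_tmul, ContinuousLinearMap.id_apply,
    inner_expVec, mul_assoc, ← Complex.exp_add, h'.inner_eq]
  simp only [restr_restr]

theorem QuantumStopTime.proj_empty (S : QuantumStopTime k) : S.proj ∅ = 0 := by
  refine ContinuousLinearMap.ext fun y => ext_inner_left ℂ fun x => ?_
  obtain ⟨μ, hμ⟩ := S.complexMeasure x y
  rw [← hμ ∅ MeasurableSet.empty]
  simp

/-- The quantum stop time `S + t`: the image of the spectral measure `S` under `s ↦ s + t`. Thus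
`(S + t)([0, u])` equals `0` if `u < t` and `S([0, u - t])` if `u ≥ t`. -/
def QuantumStopTime.addTime (S : QuantumStopTime k) (t : ℝ≥0) : QuantumStopTime k where
  proj A := S.proj ((fun s => s + (t : ℝ≥0∞)) ⁻¹' A)
  isStarProjection A hA := S.isStarProjection _ (hA.preimage (by fun_prop))
  complexMeasure x y := by
    obtain ⟨μ, hμ⟩ := S.complexMeasure x y
    have hm : Measurable fun s : ℝ≥0∞ => s + (t : ℝ≥0∞) := by fun_prop
    exact ⟨μ.map _, fun A hA => by rw [VectorMeasure.map_apply _ hm hA, hμ _ (hA.preimage hm)]⟩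
  proj_univ := S.proj_univ
  adapted_zero := by
    rcases eq_or_ne t 0 with rfl | ht
    · simpa using! S.adapted_zero
    · have e : (fun s : ℝ≥0∞ => s + (t : ℝ≥0∞)) ⁻¹' {0} = ∅ := by ext s; simp [ht]
      exact ⟨0, by rw [e, S.proj_empty, zero_smul]⟩
  adapted u hu := by
    rcases lt_trichotomy u t with h | rfl | h
    · have e : (fun s : ℝ≥0∞ => s + (t : ℝ≥0∞)) ⁻¹' Iic (u : ℝ≥0∞) = ∅ := by
        ext s
        simpa using (ENNReal.coe_lt_coe.2 h).trans_le le_add_self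
      refine ⟨0, ?_⟩
      rw [e, S.proj_empty]
      exact ext_expVec fun f g => by simp [inner_pastOp]
    · have e : (fun s : ℝ≥0∞ => s + (u : ℝ≥0∞)) ⁻¹' Iic (u : ℝ≥0∞) = {0} := by
        ext s
        constructor
        · intro hs
          by_contra h0
          have h1 : (u : ℝ≥0∞) < u + s := ENNReal.lt_add_right ENNReal.coe_ne_top h0
          rw [add_comm] at h1
          exact absurd hs (not_le.2 h1)
        · rintro rfl; simp
      obtain ⟨c, hc⟩ := S.adapted_zero
      refine ⟨c • ContinuousLinearMap.id ℂ _, ?_⟩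
      rw [e, hc]
      refine ext_expVec fun f g => ?_
      rw [inner_pastOp]
      simp only [smul_apply, ContinuousLinearMap.id_apply, inner_smul_right,
        inner_expVec]
      rw [mul_assoc, ← Complex.exp_add, (isSplit u).inner_eq]
    · obtain ⟨Y, hY⟩ := S.adapted (u - t) (tsub_pos_of_lt h)
      obtain ⟨Z, hZ⟩ := pastOp_mono (tsub_le_self : u - t ≤ u) Y
      refine ⟨Z, ?_⟩
      rw [← hZ, ← hY]
      congr 1
      ext s
      rw [mem_preimage, mem_Iic, mem_Iic, ENNReal.coe_sub]
      exact (ENNReal.le_sub_iff_add_le_right ENNReal.coe_ne_top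
        (ENNReal.coe_le_coe.2 h.le)).symm

end StopTimes

section Stopping

variable {k : Type*} [NormedAddCommGroup k] [InnerProductSpace ℂ k]
variable {𝔥 : Type*} [NormedAddCommGroup 𝔥] [InnerProductSpace ℂ 𝔥]

/-- The bounded operators on `𝔥 ⊗ F`. -/
abbrev Op (𝔥 k : Type*) [NormedAddCommGroup 𝔥] [InnerProductSpace ℂ 𝔥] [NormedAddCommGroup k]
    [InnerProductSpace ℂ k] : Type _ :=
  HilbertTensor 𝔥 (FockSpace k) →L[ℂ] HilbertTensor 𝔥 (FockSpace k)

/-- The CCR flow `σ_t(X) = I_{t)} ⊗ Γ_t X Γ_t^*`, extended by ampliation to `B(𝔥 ⊗ F)`. -/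
def ccrFlow (t : ℝ≥0) (X : Op 𝔥 k) : Op 𝔥 k :=
  (splitRight 𝔥 (isSplit t)).conjStarAlgEquiv
    (opTensor (ContinuousLinearMap.id ℂ (FockPast k t))
      (opTensor (ContinuousLinearMap.id ℂ 𝔥)
          (fockShift (k := k) t : FockSpace k →L[ℂ] FockFuture k t) ∘L X ∘L
        opTensor (ContinuousLinearMap.id ℂ 𝔥)
          ((fockShift (k := k) t).symm : FockFuture k t →L[ℂ] FockSpace k)))

/-- The CCR flow with time parameter in `[0, ∞]`, where `σ_∞` is constant with value `I`. -/
def ccrFlowExt (t : ℝ≥0∞) (X : Op 𝔥 k) : Op 𝔥 k :=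
  if t = ∞ then ContinuousLinearMap.id ℂ _ else ccrFlow t.toNNReal X

/-- Finite partitions `0 = π₀ < ⋯ < π_{n+1} = t` of `[0, t]`, as finite sets of points ordered by
inclusion, that is, by refinement. -/
abbrev Partition (t : ℝ≥0∞) : Type :=
  {π : Finset ℝ≥0∞ // 0 ∈ π ∧ t ∈ π ∧ ∀ x ∈ π, x ≤ t}

/-- The point `π_{j-1}` of the partition `π` which precedes the point `b = π_j`, where `j ≥ 1`. -/
def pred (π : Finset ℝ≥0∞) (b : ℝ≥0∞) : ℝ≥0∞ := (π.filter (· < b)).sup id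

/-- The Riemann sum `∑_{j ≥ 1} Z(π_j) S((π_{j-1}, π_j])`, where `S` acts on `𝔥 ⊗ F` by
ampliation. -/
def riemannSum (Z : ℝ≥0∞ → Op 𝔥 k) (S : QuantumStopTime k) (π : Finset ℝ≥0∞) : Op 𝔥 k :=
  ∑ b ∈ π.filter (0 < ·),
    Z b ∘L opTensor (ContinuousLinearMap.id ℂ 𝔥) (S.proj (Ioc (pred π b) b))

/-- Convergence in the strong operator topology. -/
def StrongLim {ι E : Type*} [NormedAddCommGroup E] [NormedSpace ℂ E] (l : Filter ι)
    (T : ι → E →L[ℂ] E) (L : E →L[ℂ] E) : Prop :=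
  ∀ z, Tendsto (fun i => T i z) l (𝓝 (L z))

/-- `W = σ_S(X)`, the stopped CCR flow: `σ_S(X) = st.lim_π ∑_j σ_{π_j}(X) S((π_{j-1}, π_j])`, where
`π` runs through the finite partitions of `[0, ∞]`, directed by refinement. -/
def IsStoppedFlow (S : QuantumStopTime k) (X W : Op 𝔥 k) : Prop :=
  StrongLim atTop (fun π : Partition ∞ => riemannSum (fun b => ccrFlowExt b X) S π.1) W

/-- `W = V_{S,t}` for `t ∈ (0, ∞)`: `V_{S,t} = st.lim_π ∑_j V_{π_j} S((π_{j-1}, π_j])`, where `π`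
runs through the finite partitions of `[0, t]`, directed by refinement. -/
def IsStoppedBy (V : ℝ≥0 → Op 𝔥 k) (S : QuantumStopTime k) (t : ℝ≥0) (W : Op 𝔥 k) : Prop :=
  StrongLim atTop (fun π : Partition (t : ℝ≥0∞) => riemannSum (fun b => V b.toNNReal) S π.1) W

/-- `W = V_S`, the process `V` stopped at `S`: every `V_{S,t}` exists, and
`V_S = st.lim_{t → ∞} V_{S,t}`. -/
def IsStopped (V : ℝ≥0 → Op 𝔥 k) (S : QuantumStopTime k) (W : Op 𝔥 k) : Prop :=
  ∃ Vt : ℝ≥0 → Op 𝔥 k,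
    (∀ t, 0 < t → IsStoppedBy V S t (Vt t)) ∧ StrongLim atTop Vt W

end Stopping

section Cocycles

/-- The ultraweak tensor product `𝒜 ⊗ B(K)`: the von Neumann algebra generated by the operators
`a ⊗ b` with `a ∈ 𝒜` and `b ∈ B(K)`, as a double commutant. -/
def vnTensor {𝔥 : Type*} [NormedAddCommGroup 𝔥] [InnerProductSpace ℂ 𝔥] [CompleteSpace 𝔥]
    (𝒜 : VonNeumannAlgebra 𝔥) (K : Type*) [NormedAddCommGroup K] [InnerProductSpace ℂ K] :
    Set (HilbertTensor 𝔥 K →L[ℂ] HilbertTensor 𝔥 K) :=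
  Set.centralizer (Set.centralizer {X | ∃ a ∈ 𝒜, ∃ b : K →L[ℂ] K, X = opTensor a b})

variable {k : Type*} [NormedAddCommGroup k] [InnerProductSpace ℂ k]
variable {𝔥 : Type*} [NormedAddCommGroup 𝔥] [InnerProductSpace ℂ 𝔥]

/-- The operator `P_{[t}` on `F_{[t}`: the second quantisation of the orthogonal projection `p`
acting pointwise on `L²([t, ∞); k)`. -/
def futureProj (p : k →L[ℂ] k) (t : ℝ≥0) : FockFuture k t →L[ℂ] FockFuture k t :=
  secondQuantProj (p.compLpL 2 (volume.restrict (Ici (t : ℝ))))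

theorem futureProj_expVec [CompleteSpace k] {p : k →L[ℂ] k} (hp : IsStarProjection p) (t : ℝ≥0)
    (f : L2 k (Ici (t : ℝ))) :
    futureProj p t (expVec f) = expVec (p.compLpL 2 _ f) := by
  refine secondQuantProj_expVec _ (fun f g => ?_) f
  rw [L2.inner_def, L2.inner_def]
  refine integral_congr_ae ?_
  filter_upwards [p.coeFn_compLpL (p := 2) f, p.coeFn_compLpL (p := 2) g] with s hf hg
  rw [hf, hg, ← ContinuousLinearMap.adjoint_inner_left, ← ContinuousLinearMap.star_eq_adjoint,
    hp.isSelfAdjoint.star_eq, ← mul_apply_eq_comp, hp.isIdempotentElem.eq]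

/-- The operator `A ⊗ B` on `𝔥 ⊗ F ≅ (𝔥 ⊗ F_{t)}) ⊗ F_{[t}`. -/
def pastFuture (t : ℝ≥0) (A : HilbertTensor 𝔥 (FockPast k t) →L[ℂ] HilbertTensor 𝔥 (FockPast k t))
    (B : FockFuture k t →L[ℂ] FockFuture k t) : Op 𝔥 k :=
  (splitLeft 𝔥 (isSplit t)).conjStarAlgEquiv (opTensor A B)

/-- A `p`-adapted process `V` in `𝒜 ⊗ B(F)`: `V_t = V_{t)} ⊗ P_{[t}` with
`V_{t)} ∈ 𝒜 ⊗ B(F_{t)})`, for all `t ≥ 0`. (The operators `V_{t)}` are determined by `V`.) -/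
structure AdaptedProcess [CompleteSpace 𝔥] (𝒜 : VonNeumannAlgebra 𝔥) (p : k →L[ℂ] k) where
  /-- `V_t` -/
  op : ℝ≥0 → Op 𝔥 k
  /-- `V_{t)}` -/
  past : ∀ t : ℝ≥0, HilbertTensor 𝔥 (FockPast k t) →L[ℂ] HilbertTensor 𝔥 (FockPast k t)
  op_mem : ∀ t, op t ∈ vnTensor 𝒜 (FockSpace k)
  past_mem : ∀ t, past t ∈ vnTensor 𝒜 (FockPast k t)
  op_eq : ∀ t, op t = pastFuture t (past t) (futureProj p t)

namespace AdaptedProcess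

variable [CompleteSpace 𝔥] {𝒜 : VonNeumannAlgebra 𝔥} {p : k →L[ℂ] k}

/-- The identity-adapted projection, `V̂_t = V_{t)} ⊗ I_{[t}`. -/
def hat (V : AdaptedProcess 𝒜 p) (t : ℝ≥0) : Op 𝔥 k :=
  pastFuture t (V.past t) (ContinuousLinearMap.id ℂ _)

/-- `V` is a left operator Markovian cocycle of the CCR flow: `V_{s + t} = V̂_s σ_s(V_t)`. -/
def IsCocycle (V : AdaptedProcess 𝒜 p) : Prop :=
  ∀ s t : ℝ≥0, V.op (s + t) = V.hat s ∘L ccrFlow s (V.op t)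

/-- `V_{t)}^* V_{t)} = I` for all `t ≥ 0`. -/
def IsIsometric (V : AdaptedProcess 𝒜 p) : Prop :=
  ∀ t, ContinuousLinearMap.adjoint (V.past t) ∘L V.past t = ContinuousLinearMap.id ℂ _

/-- `V` is strongly continuous: `t ↦ V_t z` is continuous for all `z`. -/
def IsStronglyContinuous (V : AdaptedProcess 𝒜 p) : Prop :=
  ∀ z, Continuous fun t => V.op t z

end AdaptedProcess

end Cocycles

end QStop

end

/-!
The summands of the Riemann sums `∑ Z(π_j) S((π_{j-1}, π_j])` are pairwise orthogonal as soon as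
`Z_b^* Z_c` commutes with `S([0, a])` whenever `a ≤ min(b, c)`. This is so if
`Z_{b + r} = J_b σ_b(Y_r)` with `J_b` isometric, since the flow `σ_b` acts trivially on the past of
`b`, where `S([0, a])` lives. By Pythagoras, a modulus of continuity of `Y` at `0` then bounds the
difference between a Riemann sum and its refinements: applied to exponential vectors, the increment
`Z_{b + r} - Z_b` only sees the shifted vectors `f(· + b)`, which for bounded `b` form a compact
set, so that the modulus is uniform in `b`. Hence all three stopped operators exist.

For the identity, `σ_s(V_t)` commutes with `S((a, s])`. So the Riemann sums of `V_{S + t}` are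
exactly products of Riemann sums of `V̂_S` and `σ_S(V_t)` along the partition translated by `-t`,
and the factorisation passes to the limit. The part `S({∞})` of `σ_S(V_t)` is annihilated by `V̂_S`.
-/

noncomputable section

namespace QStop

section ProjectionContents

variable {α E F : Type*} [MeasurableSpace α] [NormedAddCommGroup E] [InnerProductSpace ℂ E]
  [NormedAddCommGroup F] [InnerProductSpace ℂ F]

/-- A finitely additive family of orthogonal projections indexed by the measurable sets of `α`: the
finitely additive analogue of a spectral measure, with no condition on the value at `univ`. -/
structure IsProjectionContent (Q : Set α → E →L[ℂ] E) : Prop where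
  isSymmetricProjection : ∀ A, MeasurableSet A → (Q A : E →ₗ[ℂ] E).IsSymmetricProjection
  union : ∀ A B, MeasurableSet A → MeasurableSet B → Disjoint A B → Q (A ∪ B) = Q A + Q B

theorem norm_sq_sum_eq_sum_norm_sq {ι : Type*} {s : Finset ι} {v : ι → F}
    (hv : ∀ i ∈ s, ∀ j ∈ s, i ≠ j → ⟪v i, v j⟫_ℂ = 0) :
    ‖∑ i ∈ s, v i‖ ^ 2 = ∑ i ∈ s, ‖v i‖ ^ 2 := by
  have h : ⟪∑ i ∈ s, v i, ∑ i ∈ s, v i⟫_ℂ = ∑ i ∈ s, ⟪v i, v i⟫_ℂ := by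
    rw [sum_inner]
    refine Finset.sum_congr rfl fun i hi => ?_
    rw [inner_sum, Finset.sum_eq_single_of_mem i hi fun j hj hji => hv i hi j hj hji.symm]
  simp only [inner_self_eq_norm_sq_to_K] at h
  exact_mod_cast h

namespace IsProjectionContent

variable {Q : Set α → E →L[ℂ] E} (hQ : IsProjectionContent Q)
include hQ

theorem empty : Q ∅ = 0 := by
  simpa using hQ.union ∅ ∅ .empty .empty disjoint_bot_left

theorem isIdempotentElem {A : Set α} (hA : MeasurableSet A) : IsIdempotentElem (Q A) :=
  ContinuousLinearMap.isIdempotentElem_toLinearMap_iff.1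
    (hQ.isSymmetricProjection A hA).isIdempotentElem

theorem inner_left_eq {A : Set α} (hA : MeasurableSet A) (x y : E) :
    ⟪Q A x, y⟫_ℂ = ⟪x, Q A y⟫_ℂ :=
  (hQ.isSymmetricProjection A hA).isSymmetric x y

theorem apply_apply_of_disjoint {A B : Set α} (hA : MeasurableSet A) (hB : MeasurableSet B)
    (h : Disjoint A B) (x : E) : Q A (Q B x) = 0 := by
  have hAB := hQ.isIdempotentElem (hA.union hB)
  rw [hQ.union A B hA hB h,
    (hQ.isIdempotentElem hA).add_iff (hQ.isIdempotentElem hB)] at hAB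
  have : IsAddTorsionFree (E →L[ℂ] E) := .of_isTorsionFree ℂ _
  exact DFunLike.congr_fun ((hQ.isIdempotentElem hA).mul_eq_zero_of_anticommute hAB) x

theorem norm_apply_le {A : Set α} (hA : MeasurableSet A) (x : E) : ‖Q A x‖ ≤ ‖x‖ := by
  have horth : ⟪Q A x, x - Q A x⟫_ℂ = 0 := by
    rw [hQ.inner_left_eq hA, map_sub, ← mul_apply_eq_comp, (hQ.isIdempotentElem hA).eq, sub_self,
      inner_zero_right]
  have := norm_add_sq_eq_norm_sq_add_norm_sq_of_inner_eq_zero _ _ horth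
  rw [add_sub_cancel] at this
  nlinarith [norm_nonneg (Q A x), norm_nonneg x, norm_nonneg (x - Q A x)]

theorem apply_apply_of_subset {A B : Set α} (hA : MeasurableSet A) (hB : MeasurableSet B)
    (h : A ⊆ B) (x : E) : Q A (Q B x) = Q A x := by
  rw [← union_sdiff_cancel h, hQ.union A _ hA (hB.diff hA) disjoint_sdiff_right, add_apply,
    map_add, hQ.apply_apply_of_disjoint hA (hB.diff hA) disjoint_sdiff_right, add_zero,
    ← mul_apply_eq_comp, (hQ.isIdempotentElem hA).eq]

theorem norm_apply_mono {A B : Set α} (hA : MeasurableSet A) (hB : MeasurableSet B) (h : A ⊆ B)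
    (x : E) : ‖Q A x‖ ≤ ‖Q B x‖ := by
  rw [← hQ.apply_apply_of_subset hA hB h]
  exact hQ.norm_apply_le hA _

theorem biUnion {ι : Type*} {s : Finset ι} {A : ι → Set α} (hA : ∀ i, MeasurableSet (A i))
    (hd : (s : Set ι).PairwiseDisjoint A) : Q (⋃ i ∈ s, A i) = ∑ i ∈ s, Q (A i) := by
  classical
  induction s using Finset.induction_on with
  | empty => simp [hQ.empty]
  | insert i s hi ih =>
    rw [Finset.set_biUnion_insert, Finset.sum_insert hi, hQ.union _ _ (hA i)
      (s.measurableSet_biUnion fun j _ => hA j), ih]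
    · exact hd.subset (by simp)
    · rw [Set.disjoint_iUnion₂_right]
      intro j hj
      exact hd (by simp) (by simp [hj]) (by rintro rfl; exact hi hj)

theorem Ioc_eq_sub [LinearOrder α] [TopologicalSpace α] [OrderClosedTopology α]
    [OpensMeasurableSpace α] {a b : α} (h : a ≤ b) : Q (Ioc a b) = Q (Iic b) - Q (Iic a) := by
  rw [← Iic_union_Ioc_eq_Iic h, hQ.union _ _ measurableSet_Iic measurableSet_Ioc
    (Iic_disjoint_Ioc le_rfl), add_sub_cancel_left]

theorem norm_sum_le_of_inner_eq_zero {ι : Type*} {s : Finset ι} {A : ι → Set α}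
    (hA : ∀ i, MeasurableSet (A i)) (hd : (s : Set ι).PairwiseDisjoint A) {B : Set α}
    (hB : MeasurableSet B) (hAB : ∀ i ∈ s, A i ⊆ B) {v : ι → F}
    (hv : ∀ i ∈ s, ∀ j ∈ s, i ≠ j → ⟪v i, v j⟫_ℂ = 0) {M : ℝ} (hM : 0 ≤ M) (x : E)
    (hvQ : ∀ i ∈ s, ‖v i‖ ≤ M * ‖Q (A i) x‖) :
    ‖∑ i ∈ s, v i‖ ≤ M * ‖Q B x‖ := by
  have hQA : ∀ i ∈ s, ∀ j ∈ s, i ≠ j → ⟪Q (A i) x, Q (A j) x⟫_ℂ = 0 := fun i hi j hj hij => by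
    rw [hQ.inner_left_eq (hA i), hQ.apply_apply_of_disjoint (hA i) (hA j) (hd hi hj hij),
      inner_zero_right]
  refine le_of_sq_le_sq ?_ (by positivity)
  calc ‖∑ i ∈ s, v i‖ ^ 2 = ∑ i ∈ s, ‖v i‖ ^ 2 := norm_sq_sum_eq_sum_norm_sq hv
    _ ≤ ∑ i ∈ s, M ^ 2 * ‖Q (A i) x‖ ^ 2 := by
      refine Finset.sum_le_sum fun i hi => ?_
      rw [← mul_pow]
      exact pow_le_pow_left₀ (norm_nonneg _) (hvQ i hi) 2
    _ = M ^ 2 * ‖Q (⋃ i ∈ s, A i) x‖ ^ 2 := by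
      rw [← Finset.mul_sum, hQ.biUnion hA hd, sum_apply, norm_sq_sum_eq_sum_norm_sq hQA]
    _ ≤ (M * ‖Q B x‖) ^ 2 := by
      rw [mul_pow]
      gcongr
      exact hQ.norm_apply_mono (s.measurableSet_biUnion fun i _ => hA i) hB
        (iUnion₂_subset hAB) x

end IsProjectionContent

end ProjectionContents

section Partitions

/-- The point of `π` closest to `s` from the right, or `∞` if there is none. -/
def next (π : Finset ℝ≥0∞) (s : ℝ≥0∞) : ℝ≥0∞ := (π.filter (s ≤ ·)).inf id

theorem next_le {π : Finset ℝ≥0∞} {s b : ℝ≥0∞} (hb : b ∈ π) (h : s ≤ b) : next π s ≤ b :=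
  Finset.inf_le (f := id) (Finset.mem_filter.2 ⟨hb, h⟩)

theorem le_next (π : Finset ℝ≥0∞) (s : ℝ≥0∞) : s ≤ next π s :=
  Finset.le_inf fun _ hb => (Finset.mem_filter.1 hb).2

theorem next_mem {π : Finset ℝ≥0∞} {s T : ℝ≥0∞} (hT : T ∈ π) (h : s ≤ T) : next π s ∈ π := by
  obtain ⟨b, hb, e⟩ := Finset.exists_mem_eq_inf _ ⟨T, Finset.mem_filter.2 ⟨hT, h⟩⟩ id
  rw [next, e]
  exact (Finset.mem_filter.1 hb).1

theorem next_next {π₀ π : Finset ℝ≥0∞} (h : π₀ ⊆ π) {s T : ℝ≥0∞} (hT : T ∈ π₀) (hs : s ≤ T) :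
    next π₀ (next π s) = next π₀ s := by
  have hle : next π s ≤ next π₀ s := next_le (h (next_mem hT hs)) (le_next _ _)
  refine le_antisymm (next_le (next_mem hT hs) hle) ?_
  exact next_le (next_mem hT (next_le (h hT) hs)) ((le_next _ _).trans (le_next _ _))

theorem pred_lt_iff {π : Finset ℝ≥0∞} {b s : ℝ≥0∞} (hs : 0 < s) :
    pred π b < s ↔ ∀ y ∈ π, y < b → y < s := by
  simp [pred, Finset.sup_lt_iff (bot_lt_iff_ne_bot.2 hs.ne')]

theorem le_pred {π : Finset ℝ≥0∞} {y b : ℝ≥0∞} (hy : y ∈ π) (h : y < b) : y ≤ pred π b :=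
  Finset.le_sup (f := id) (Finset.mem_filter.2 ⟨hy, h⟩)

theorem pred_le (π : Finset ℝ≥0∞) (b : ℝ≥0∞) : pred π b ≤ b :=
  Finset.sup_le fun _ hy => (Finset.mem_filter.1 hy).2.le

theorem pred_filter_le {π : Finset ℝ≥0∞} {b T : ℝ≥0∞} (h : b ≤ T) :
    pred (π.filter (· ≤ T)) b = pred π b := by
  rw [pred, pred, Finset.filter_filter]
  congr 1
  exact Finset.filter_congr fun x _ => ⟨And.right, fun hx => ⟨hx.le.trans h, hx⟩⟩

theorem mem_Ioc_pred {π : Finset ℝ≥0∞} {b s : ℝ≥0∞} (hb : b ∈ π) :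
    s ∈ Ioc (pred π b) b ↔ 0 < s ∧ s ≤ b ∧ next π s = b := by
  constructor
  · rintro ⟨hlt, hle⟩
    have hs : 0 < s := bot_le.trans_lt hlt
    refine ⟨hs, hle, le_antisymm (next_le hb hle) (Finset.le_inf fun y hy => ?_)⟩
    rw [Finset.mem_filter] at hy
    by_contra! hyb
    exact ((pred_lt_iff hs).1 hlt y hy.1 hyb).not_ge hy.2
  · rintro ⟨hs, hle, rfl⟩
    refine ⟨(pred_lt_iff hs).2 fun y hy hlt => ?_, hle⟩
    by_contra! hsy
    exact (next_le hy hsy).not_gt hlt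

theorem pairwiseDisjoint_Ioc_pred (π : Finset ℝ≥0∞) :
    (π : Set ℝ≥0∞).PairwiseDisjoint fun b => Ioc (pred π b) b := by
  intro b hb c hc hbc
  rw [Function.onFun, Set.disjoint_left]
  intro s hsb hsc
  exact hbc (((mem_Ioc_pred hb).1 hsb).2.2.symm.trans ((mem_Ioc_pred hc).1 hsc).2.2)

theorem Ioc_pred_eq_biUnion {π₀ π : Finset ℝ≥0∞} (h : π₀ ⊆ π) {T : ℝ≥0∞} (hT : T ∈ π₀)
    (hmax : ∀ b ∈ π₀, b ≤ T) {b₀ : ℝ≥0∞} (hb₀ : b₀ ∈ π₀) :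
    Ioc (pred π₀ b₀) b₀ =
      ⋃ b ∈ (π.filter (0 < ·)).filter (next π₀ · = b₀), Ioc (pred π b) b := by
  ext s
  simp only [mem_iUnion, Finset.mem_filter, exists_prop]
  constructor
  · intro hs
    obtain ⟨hs0, hsb₀, hnext⟩ := (mem_Ioc_pred hb₀).1 hs
    have hsT := hsb₀.trans (hmax _ hb₀)
    have hmem := next_mem (h hT) hsT
    refine ⟨next π s, ⟨⟨hmem, hs0.trans_le (le_next _ _)⟩, ?_⟩,
      (mem_Ioc_pred hmem).2 ⟨hs0, le_next _ _, rfl⟩⟩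
    rw [next_next h hT hsT, hnext]
  · rintro ⟨b, ⟨⟨hb, -⟩, rfl⟩, hs⟩
    obtain ⟨hs0, hsb, rfl⟩ := (mem_Ioc_pred hb).1 hs
    have hle : next π s ≤ T := (le_next π₀ _).trans (hmax _ hb₀)
    exact (mem_Ioc_pred hb₀).2 ⟨hs0, (le_next _ _).trans (le_next _ _),
      (next_next h hT (hsb.trans hle)).symm⟩

instance (t : ℝ≥0∞) : Nonempty (Partition t) :=
  ⟨⟨{0, t}, by simp, by simp, by simp⟩⟩

instance (t : ℝ≥0∞) : IsDirectedOrder (Partition t) :=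
  ⟨fun π π' => ⟨⟨π.1 ∪ π'.1, Finset.mem_union_left _ π.2.1, Finset.mem_union_left _ π.2.2.1,
    fun x hx => (Finset.mem_union.1 hx).elim (π.2.2.2 x) (π'.2.2.2 x)⟩,
    Finset.subset_union_left, Finset.subset_union_right⟩⟩

theorem exists_partition_next_le (T : ℝ≥0) {δ : ℝ≥0} (hδ : 0 < δ) :
    ∃ π₀ : Partition (T : ℝ≥0∞), ∀ s : ℝ≥0, s ≤ T → next π₀.1 s ≤ ((s + δ : ℝ≥0) : ℝ≥0∞) := by
  let g : ℕ → ℝ≥0∞ := fun n => ((min (n * δ) T : ℝ≥0) : ℝ≥0∞)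
  refine ⟨⟨insert 0 (insert (T : ℝ≥0∞) ((Finset.range (⌈T / δ⌉₊ + 1)).image g)), by simp, by simp,
    ?_⟩, fun s hs => ?_⟩
  · intro x hx
    simp only [Finset.mem_insert, Finset.mem_image] at hx
    rcases hx with rfl | rfl | ⟨n, -, rfl⟩
    · simp
    · exact le_rfl
    · exact ENNReal.coe_le_coe.2 (min_le_right _ _)
  · have hmem : ⌈s / δ⌉₊ ∈ Finset.range (⌈T / δ⌉₊ + 1) :=
      Finset.mem_range_succ_iff.2 (Nat.ceil_mono (by gcongr))
    have hle : s ≤ min (⌈s / δ⌉₊ * δ) T := le_min ((div_le_iff₀ hδ).1 (Nat.le_ceil _)) hs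
    have hge : min (⌈s / δ⌉₊ * δ) T ≤ s + δ := by
      calc min (⌈s / δ⌉₊ * δ) T ≤ ⌈s / δ⌉₊ * δ := min_le_left _ _
        _ ≤ (s / δ + 1) * δ := by gcongr; exact (Nat.ceil_lt_add_one zero_le).le
        _ = s + δ := by field_simp
    refine (next_le ?_ (ENNReal.coe_le_coe.2 hle)).trans (ENNReal.coe_le_coe.2 hge)
    exact Finset.mem_insert_of_mem (Finset.mem_insert_of_mem (Finset.mem_image_of_mem g hmem))

/-- The restriction to `[0, T]` of a partition of `[0, U]`, where `T ≤ U`. -/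
def truncPartition {T U : ℝ≥0∞} (π : Partition U) : Partition T :=
  ⟨insert 0 (insert T (π.1.filter (· ≤ T))), by simp, by simp, by
    intro x hx
    simp only [Finset.mem_insert, Finset.mem_filter] at hx
    rcases hx with rfl | rfl | hx
    exacts [zero_le, le_rfl, hx.2]⟩

theorem eventually_mem_partition {T U : ℝ≥0∞} (h : T ≤ U) :
    ∀ᶠ π : Partition U in atTop, T ∈ π.1 := by
  filter_upwards [eventually_ge_atTop (⟨{0, T, U}, by simp, by simp, by simp [h]⟩ : Partition U)]
    with π hπ
  exact hπ (by simp)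

theorem tendsto_truncPartition {T U : ℝ≥0∞} (h : T ≤ U) :
    Tendsto (truncPartition : Partition U → Partition T) atTop atTop := by
  refine tendsto_atTop.2 fun π₀ => ?_
  have hU : ∀ x ∈ insert U π₀.1, x ≤ U := by
    intro x hx
    rcases Finset.mem_insert.1 hx with rfl | hx
    exacts [le_rfl, (π₀.2.2.2 x hx).trans h]
  filter_upwards [eventually_ge_atTop (⟨insert U π₀.1, by simp [π₀.2.1], by simp, hU⟩ :
    Partition U)] with π hπ x hx
  have : x ∈ π.1 := hπ (Finset.mem_insert_of_mem hx)
  simp [truncPartition, this, π₀.2.2.2 x hx]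

theorem truncPartition_eq_filter {T U : ℝ≥0∞} {π : Partition U} (hT : T ∈ π.1) :
    (truncPartition π : Partition T).1 = π.1.filter (· ≤ T) := by
  simp [truncPartition, π.2.1, hT]

end Partitions

section RiemannSums

variable {E : Type*} [NormedAddCommGroup E] [InnerProductSpace ℂ E]
  {Q : Set ℝ≥0∞ → E →L[ℂ] E} {Z : ℝ≥0∞ → E →L[ℂ] E} {M : ℝ}

/-- The Riemann sum `∑_{j ≥ 1} Z(π_j) Q((π_{j-1}, π_j])` of an operator-valued function `Z` with
respect to an operator-valued set function `Q`. -/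
def projSum (Z : ℝ≥0∞ → E →L[ℂ] E) (Q : Set ℝ≥0∞ → E →L[ℂ] E) (π : Finset ℝ≥0∞) : E →L[ℂ] E :=
  ∑ b ∈ π.filter (0 < ·), Z b ∘L Q (Ioc (pred π b) b)

theorem projSum_apply (Z : ℝ≥0∞ → E →L[ℂ] E) (Q : Set ℝ≥0∞ → E →L[ℂ] E) (π : Finset ℝ≥0∞)
    (x : E) : projSum Z Q π x = ∑ b ∈ π.filter (0 < ·), Z b (Q (Ioc (pred π b) b) x) := by
  simp [projSum]

theorem projSum_apply_eq_of_subset (hQ : IsProjectionContent Q) (Z : ℝ≥0∞ → E →L[ℂ] E)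
    {π₀ π : Finset ℝ≥0∞} (h : π₀ ⊆ π) {T : ℝ≥0∞} (hT : T ∈ π₀) (hmax : ∀ b ∈ π, b ≤ T) (x : E) :
    projSum Z Q π₀ x = ∑ b ∈ π.filter (0 < ·), Z (next π₀ b) (Q (Ioc (pred π b) b) x) := by
  have hmaps : ∀ b ∈ π.filter (0 < ·), next π₀ b ∈ π₀.filter (0 < ·) := by
    intro b hb
    rw [Finset.mem_filter] at hb ⊢
    exact ⟨next_mem hT (hmax b hb.1), hb.2.trans_le (le_next _ _)⟩
  rw [projSum_apply, ← Finset.sum_fiberwise_of_maps_to hmaps]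
  refine Finset.sum_congr rfl fun b₀ hb₀ => ?_
  have hsub : (π.filter (0 < ·)).filter (next π₀ · = b₀) ⊆ π :=
    (Finset.filter_subset _ _).trans (Finset.filter_subset _ _)
  rw [Ioc_pred_eq_biUnion h hT (fun b hb => hmax b (h hb)) (Finset.mem_filter.1 hb₀).1,
    hQ.biUnion (fun _ => measurableSet_Ioc)
      ((pairwiseDisjoint_Ioc_pred π).subset (Finset.coe_subset.2 hsub)), sum_apply, map_sum]
  refine Finset.sum_congr rfl fun b hb => ?_
  rw [(Finset.mem_filter.1 hb).2]

theorem projSum_apply_sub_truncPartition (Z : ℝ≥0∞ → E →L[ℂ] E) (Q : Set ℝ≥0∞ → E →L[ℂ] E)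
    {T U : ℝ≥0∞} {π : Partition U} (hT : T ∈ π.1) (x : E) :
    projSum Z Q π.1 x - projSum Z Q (truncPartition π : Partition T).1 x =
      ∑ b ∈ π.1.filter (T < ·), Z b (Q (Ioc (pred π.1 b) b) x) := by
  have hle : projSum Z Q (truncPartition π : Partition T).1 x =
      ∑ b ∈ (π.1.filter (0 < ·)).filter (· ≤ T), Z b (Q (Ioc (pred π.1 b) b) x) := by
    rw [projSum_apply, truncPartition_eq_filter hT, Finset.filter_comm]
    refine Finset.sum_congr rfl fun b hb => ?_
    rw [pred_filter_le (Finset.mem_filter.1 hb).2]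
  have hlt : (π.1.filter (0 < ·)).filter (¬ · ≤ T) = π.1.filter (T < ·) := by
    rw [Finset.filter_filter]
    refine Finset.filter_congr fun b _ => ?_
    rw [not_le]
    exact and_iff_right_of_imp bot_le.trans_lt
  rw [hle, projSum_apply, sub_eq_iff_eq_add',
    ← Finset.sum_filter_add_sum_filter_not (π.1.filter (0 < ·)) (· ≤ T), hlt]

/-- An operator-valued function `Z`, bounded by `M`, such that `Z(b)^* Z(c)` commutes with the
projections `Q([0, a])`, `a ≤ min(b, c)`. This makes the summands of its Riemann sums pairwise
orthogonal. -/
structure IsOrthoIntegrand (Q : Set ℝ≥0∞ → E →L[ℂ] E) (Z : ℝ≥0∞ → E →L[ℂ] E) (M : ℝ) : Prop where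
  nonneg : 0 ≤ M
  bound : ∀ b x, ‖Z b x‖ ≤ M * ‖x‖
  ortho : ∀ a b c, a ≤ b → a ≤ c → ∀ x y,
    ⟪Z b (Q (Iic a) x), Z c y⟫_ℂ = ⟪Z b x, Z c (Q (Iic a) y)⟫_ℂ

namespace IsOrthoIntegrand

variable (hZ : IsOrthoIntegrand Q Z M) (hQ : IsProjectionContent Q)
include hZ hQ

theorem inner_apply_Ioc {a b c d : ℝ≥0∞} (hab : a ≤ b) (hc : b ≤ c) (hd : b ≤ d) (x y : E) :
    ⟪Z c (Q (Ioc a b) x), Z d y⟫_ℂ = ⟪Z c x, Z d (Q (Ioc a b) y)⟫_ℂ := by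
  rw [hQ.Ioc_eq_sub hab]
  simp only [sub_apply, map_sub, inner_sub_left, inner_sub_right]
  rw [hZ.ortho b c d hc hd, hZ.ortho a c d (hab.trans hc) (hab.trans hd)]

theorem inner_Ioc_pred_eq_zero {π : Finset ℝ≥0∞} {b c b' c' : ℝ≥0∞} (hb : b ∈ π) (hc : c ∈ π)
    (hbc : b ≠ c) (hb' : b ≤ b') (hc' : c ≤ c') (x y : E) :
    ⟪Z b' (Q (Ioc (pred π b) b) x), Z c' (Q (Ioc (pred π c) c) y)⟫_ℂ = 0 := by
  wlog h : b < c generalizing b c b' c' x y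
  · rw [← inner_conj_symm, this hc hb hbc.symm hc' hb' y x (hbc.lt_or_gt.resolve_left h), map_zero]
  rw [hZ.inner_apply_Ioc hQ (pred_le _ _) hb' (h.le.trans hc'), hQ.apply_apply_of_disjoint
    measurableSet_Ioc measurableSet_Ioc (pairwiseDisjoint_Ioc_pred π hb hc hbc), map_zero,
    inner_zero_right]

theorem norm_sum_le {π s : Finset ℝ≥0∞} (hs : s ⊆ π) {A : Set ℝ≥0∞} (hA : MeasurableSet A)
    (hsA : ∀ b ∈ s, Ioc (pred π b) b ⊆ A) (x : E) :
    ‖∑ b ∈ s, Z b (Q (Ioc (pred π b) b) x)‖ ≤ M * ‖Q A x‖ :=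
  hQ.norm_sum_le_of_inner_eq_zero (fun _ => measurableSet_Ioc)
    ((pairwiseDisjoint_Ioc_pred π).subset (Finset.coe_subset.2 hs)) hA hsA
    (fun _ hb _ hc hbc => hZ.inner_Ioc_pred_eq_zero hQ (hs hb) (hs hc) hbc le_rfl le_rfl x x)
    hZ.nonneg x fun b _ => hZ.bound b _

theorem norm_projSum_le (π : Finset ℝ≥0∞) (x : E) : ‖projSum Z Q π x‖ ≤ M * ‖x‖ := by
  rw [projSum_apply]
  refine (hZ.norm_sum_le hQ (Finset.filter_subset _ _) .univ (fun _ _ => subset_univ _) x).trans ?_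
  exact mul_le_mul_of_nonneg_left (hQ.norm_apply_le .univ x) hZ.nonneg

theorem norm_projSum_sub_le {π₀ π : Finset ℝ≥0∞} (h : π₀ ⊆ π) {T : ℝ≥0∞} (hT : T ∈ π₀)
    (hmax : ∀ b ∈ π, b ≤ T) {ε : ℝ} (hε : 0 ≤ ε) (x : E)
    (hx : ∀ a b, a ≤ b → b ≤ T → ‖Z b (Q (Ioc a b) x) - Z (next π₀ b) (Q (Ioc a b) x)‖ ≤
      ε * ‖Q (Ioc a b) x‖) :
    ‖projSum Z Q π x - projSum Z Q π₀ x‖ ≤ ε * ‖x‖ := by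
  have hsub : π.filter (0 < ·) ⊆ π := Finset.filter_subset _ _
  rw [projSum_apply_eq_of_subset hQ Z h hT hmax, projSum_apply, ← Finset.sum_sub_distrib]
  refine (hQ.norm_sum_le_of_inner_eq_zero (fun _ => measurableSet_Ioc)
    ((pairwiseDisjoint_Ioc_pred π).subset (Finset.coe_subset.2 hsub)) .univ
    (fun _ _ => subset_univ _) (fun b hb c hc hbc => ?_) hε x
    fun b hb => hx _ _ (pred_le _ _) (hmax _ (hsub hb))).trans
    (mul_le_mul_of_nonneg_left (hQ.norm_apply_le .univ x) hε)
  have horth {b' c' : ℝ≥0∞} (hb' : b ≤ b') (hc' : c ≤ c') :=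
    hZ.inner_Ioc_pred_eq_zero hQ (hsub hb) (hsub hc) hbc hb' hc' x x
  simp only [inner_sub_left, inner_sub_right, horth, le_refl, le_next, sub_zero]

theorem norm_projSum_sub_truncPartition_le (hZtop : Z ∞ = 0) {T U : ℝ≥0∞} {π : Partition U}
    (hT : T ∈ π.1) (x : E) :
    ‖projSum Z Q π.1 x - projSum Z Q (truncPartition π : Partition T).1 x‖ ≤
      M * ‖Q (Ioo T ∞) x‖ := by
  have htop : ∀ b ∈ π.1.filter (T < ·), Z b (Q (Ioc (pred π.1 b) b) x) ≠ 0 → b ≠ ∞ := by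
    rintro b - hb rfl
    simp [hZtop] at hb
  rw [projSum_apply_sub_truncPartition Z Q hT, ← Finset.sum_filter_of_ne htop]
  refine hZ.norm_sum_le hQ ((Finset.filter_subset _ _).trans (Finset.filter_subset _ _))
    measurableSet_Ioo (fun b hb s hs => ?_) x
  obtain ⟨hbT, hbtop⟩ := Finset.mem_filter.1 hb
  exact ⟨(le_pred hT (Finset.mem_filter.1 hbT).2).trans_lt hs.1, hs.2.trans_lt hbtop.lt_top⟩

end IsOrthoIntegrand

end RiemannSums

section StrongLimits

variable {ι : Type*} {l : Filter ι}

theorem exists_tendsto_of_eventually_dist_le {X : Type*} [PseudoMetricSpace X] [CompleteSpace X]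
    [NeBot l] {f : ι → X} (h : ∀ ε > 0, ∃ y, ∀ᶠ i in l, dist (f i) y ≤ ε) :
    ∃ y, Tendsto f l (𝓝 y) := by
  rw [← cauchy_map_iff_exists_tendsto, Metric.cauchy_iff]
  refine ⟨inferInstance, fun ε hε => ?_⟩
  obtain ⟨y, hy⟩ := h (ε / 3) (by positivity)
  refine ⟨Metric.closedBall y (ε / 3), hy, fun a ha b hb => ?_⟩
  have := dist_triangle_right a b y
  rw [Metric.mem_closedBall] at ha hb
  linarith

theorem isClosed_setOf_exists_tendsto {X Y : Type*} [PseudoMetricSpace X] [PseudoMetricSpace Y]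
    [CompleteSpace Y] [NeBot l] {f : ι → X → Y} {K : ℝ≥0} (hf : ∀ i, LipschitzWith K (f i)) :
    IsClosed {x | ∃ y, Tendsto (fun i => f i x) l (𝓝 y)} := by
  refine isClosed_of_closure_subset fun x hx => exists_tendsto_of_eventually_dist_le fun ε hε => ?_
  obtain ⟨z, ⟨y, hy⟩, hxz⟩ := Metric.mem_closure_iff.1 hx (ε / 2 / (K + 1)) (by positivity)
  have hK : K * dist x z ≤ ε / 2 := by
    rw [lt_div_iff₀ (by positivity)] at hxz
    nlinarith [dist_nonneg (x := x) (y := z)]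
  refine ⟨y, ?_⟩
  filter_upwards [Metric.tendsto_nhds.1 hy (ε / 2) (by positivity)] with i hi
  linarith [dist_triangle (f i x) (f i z) y, (hf i).dist_le_mul x z]

variable {E : Type*} [NormedAddCommGroup E] [NormedSpace ℂ E] {T : ι → E →L[ℂ] E} {M : ℝ}

theorem StrongLim.unique [NeBot l] {L L' : E →L[ℂ] E} (h : StrongLim l T L)
    (h' : StrongLim l T L') : L = L' :=
  ContinuousLinearMap.ext fun z => tendsto_nhds_unique (h z) (h' z)

theorem StrongLim.tendsto_apply {L : E →L[ℂ] E} (hM : ∀ i x, ‖T i x‖ ≤ M * ‖x‖)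
    (hT : StrongLim l T L) {y : ι → E} {y₀ : E} (hy : Tendsto y l (𝓝 y₀)) :
    Tendsto (fun i => T i (y i)) l (𝓝 (L y₀)) := by
  have hdiff : Tendsto (fun i => T i (y i - y₀)) l (𝓝 0) := by
    refine squeeze_zero_norm (fun i => hM i _) ?_
    simpa using (hy.sub_const y₀).norm.const_mul M
  simpa using hdiff.add (hT y₀)

theorem StrongLim.comp {S : ι → E →L[ℂ] E} {K L : E →L[ℂ] E} (hM : ∀ i x, ‖S i x‖ ≤ M * ‖x‖)
    (hS : StrongLim l S K) (hT : StrongLim l T L) :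
    StrongLim l (fun i => S i ∘L T i) (K ∘L L) :=
  fun z => hS.tendsto_apply hM (hT z)

theorem StrongLim.tendstoUniformlyOn {L : E →L[ℂ] E} (hM : ∀ i x, ‖T i x‖ ≤ M * ‖x‖)
    (hT : StrongLim l T L) {K : Set E} (hK : IsCompact K) :
    TendstoUniformlyOn (fun i x => T i x) L l K := by
  have hlip : ∀ i, LipschitzWith M.toNNReal (T i) := fun i =>
    AddMonoidHomClass.lipschitz_of_bound _ M (hM i)
  have := isCompact_iff_compactSpace.1 hK
  have heq : Equicontinuous fun (i : ι) (x : K) => T i x :=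
    equicontinuous_restrict_iff _ |>.2 <|
      (LipschitzWith.uniformEquicontinuous _ _ hlip).equicontinuous.equicontinuousOn K
  refine tendstoUniformlyOn_iff_tendstoUniformly_comp_coe.2
    (UniformFun.tendsto_iff_tendstoUniformly.1 ((heq.tendsto_uniformFun_iff_pi _ _).2 ?_))
  exact tendsto_pi_nhds.2 fun x => hT x

theorem exists_strongLim_of_forall_exists_tendsto [NeBot l] (hM : ∀ i x, ‖T i x‖ ≤ M * ‖x‖)
    (h : ∀ x, ∃ y, Tendsto (fun i => T i x) l (𝓝 y)) :
    ∃ L : E →L[ℂ] E, StrongLim l T L ∧ ∀ x, ‖L x‖ ≤ M * ‖x‖ := by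
  choose L hL using h
  have hbound : ∀ x, ‖L x‖ ≤ M * ‖x‖ := fun x =>
    le_of_tendsto (hL x).norm (Eventually.of_forall fun i => hM i x)
  exact ⟨(linearMapOfTendsto L (fun i => (T i : E →ₗ[ℂ] E)) (tendsto_pi_nhds.2 hL)).mkContinuous
    M hbound, hL, hbound⟩

variable [CompleteSpace E] [NeBot l]

theorem exists_strongLim_of_total (hM : ∀ i x, ‖T i x‖ ≤ M * ‖x‖)
    {D : Set E} (hD : (Submodule.span ℂ D).topologicalClosure = ⊤)
    (h : ∀ x ∈ D, ∃ y, Tendsto (fun i => T i x) l (𝓝 y)) :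
    ∃ L : E →L[ℂ] E, StrongLim l T L ∧ ∀ x, ‖L x‖ ≤ M * ‖x‖ := by
  have hspan : (Submodule.span ℂ D : Set E) ⊆ {x | ∃ y, Tendsto (fun i => T i x) l (𝓝 y)} := by
    intro x hx
    induction hx using Submodule.span_induction with
    | mem x hx => exact h x hx
    | zero => exact ⟨0, by simp⟩
    | add x y _ _ hx hy =>
      obtain ⟨a, ha⟩ := hx
      obtain ⟨b, hb⟩ := hy
      exact ⟨a + b, by simpa using ha.add hb⟩
    | smul c x _ hx =>
      obtain ⟨a, ha⟩ := hx
      exact ⟨c • a, by simpa using ha.const_smul c⟩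
  have hlip : ∀ i, LipschitzWith M.toNNReal (T i) := fun i =>
    AddMonoidHomClass.lipschitz_of_bound (T i) M (hM i)
  refine exists_strongLim_of_forall_exists_tendsto hM fun x => ?_
  refine closure_minimal hspan (isClosed_setOf_exists_tendsto hlip) ?_
  rw [← Submodule.topologicalClosure_coe, hD]
  trivial

theorem strongLim_of_total (hM : ∀ i x, ‖T i x‖ ≤ M * ‖x‖) {D : Set E}
    (hD : (Submodule.span ℂ D).topologicalClosure = ⊤) (L : E →L[ℂ] E)
    (h : ∀ x ∈ D, Tendsto (fun i => T i x) l (𝓝 (L x))) : StrongLim l T L := by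
  obtain ⟨L', hL', -⟩ := exists_strongLim_of_total hM hD fun x hx => ⟨_, h x hx⟩
  have : L' = L := ContinuousLinearMap.ext_on (Submodule.dense_iff_topologicalClosure_eq_top.2 hD)
    fun x hx => tendsto_nhds_unique (hL' x) (h x hx)
  rwa [← this]

end StrongLimits

section Convergence

variable {E : Type*} [NormedAddCommGroup E] [InnerProductSpace ℂ E]
  {Q : Set ℝ≥0∞ → E →L[ℂ] E} {Z : ℝ≥0∞ → E →L[ℂ] E} {M : ℝ}

/-- Uniform right-continuity of `Z` on bounded intervals, relative to the vectors `Q((a, c]) x` with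
`c` the base point: the modulus of continuity does not depend on `a`, on `c` or on the norm. -/
def IsUniformlyRightContinuous (Q : Set ℝ≥0∞ → E →L[ℂ] E) (Z : ℝ≥0∞ → E →L[ℂ] E) (x : E) : Prop :=
  ∀ T : ℝ≥0, ∀ ε > 0, ∃ δ : ℝ≥0, 0 < δ ∧ ∀ a c b : ℝ≥0, a ≤ c → c ≤ b → b ≤ c + δ → b ≤ T →
    ‖Z b (Q (Ioc (a : ℝ≥0∞) c) x) - Z c (Q (Ioc (a : ℝ≥0∞) c) x)‖ ≤
      ε * ‖Q (Ioc (a : ℝ≥0∞) c) x‖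

namespace IsOrthoIntegrand

variable (hZ : IsOrthoIntegrand Q Z M) (hQ : IsProjectionContent Q)
include hZ hQ

theorem norm_strongLim_projSum_sub_le (hZtop : Z ∞ = 0) {T U : ℝ≥0∞} (hTU : T ≤ U)
    {L L' : E →L[ℂ] E} (hL : StrongLim atTop (fun π : Partition T => projSum Z Q π.1) L)
    (hL' : StrongLim atTop (fun π : Partition U => projSum Z Q π.1) L') (x : E) :
    ‖L' x - L x‖ ≤ M * ‖Q (Ioo T ∞) x‖ := by
  refine le_of_tendsto ((hL' x).sub ((hL x).comp (tendsto_truncPartition hTU))).norm ?_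
  filter_upwards [eventually_mem_partition hTU] with π hπ
  exact hZ.norm_projSum_sub_truncPartition_le hQ hZtop hπ x

theorem tendsto_projSum_of_strongLim (hZtop : Z ∞ = 0) {Wt : ℝ≥0 → E →L[ℂ] E} {W : E →L[ℂ] E}
    (hWt : ∀ T : ℝ≥0, StrongLim atTop (fun π : Partition (T : ℝ≥0∞) => projSum Z Q π.1) (Wt T))
    (hW : StrongLim atTop Wt W) {x : E}
    (hx : Tendsto (fun T : ℝ≥0 => M * ‖Q (Ioo (T : ℝ≥0∞) ∞) x‖) atTop (𝓝 0)) :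
    Tendsto (fun π : Partition ∞ => projSum Z Q π.1 x) atTop (𝓝 (W x)) := by
  refine Metric.tendsto_nhds.2 fun ε hε => ?_
  obtain ⟨T, hT, hWT⟩ := ((hx.eventually_lt_const (show 0 < ε / 3 by positivity)).and
    (Metric.tendsto_nhds.1 (hW x) (ε / 3) (by positivity))).exists
  have htrunc := (hWt T x).comp (tendsto_truncPartition (U := ∞) le_top)
  filter_upwards [eventually_mem_partition (T := (T : ℝ≥0∞)) le_top,
    Metric.tendsto_nhds.1 htrunc (ε / 3) (by positivity)] with π hπ hπT
  have hdiff := hZ.norm_projSum_sub_truncPartition_le hQ hZtop hπ x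
  rw [← dist_eq_norm] at hdiff
  have := dist_triangle4 (projSum Z Q π.1 x)
    (projSum Z Q (truncPartition π : Partition (T : ℝ≥0∞)).1 x) (Wt T x) (W x)
  simp only [Function.comp_apply] at hπT
  linarith

variable [CompleteSpace E]

theorem exists_tendsto_projSum {x : E} (hx : IsUniformlyRightContinuous Q Z x) (T : ℝ≥0) :
    ∃ y, Tendsto (fun π : Partition (T : ℝ≥0∞) => projSum Z Q π.1 x) atTop (𝓝 y) := by
  refine exists_tendsto_of_eventually_dist_le fun ε hε => ?_
  have hε' : 0 < ε / (‖x‖ + 1) := by positivity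
  obtain ⟨δ, hδ, hmod⟩ := hx T _ hε'
  obtain ⟨π₀, hπ₀⟩ := exists_partition_next_le T hδ
  refine ⟨projSum Z Q π₀.1 x, ?_⟩
  filter_upwards [eventually_ge_atTop π₀] with π hπ
  have hmesh : ∀ a c : ℝ≥0∞, a ≤ c → c ≤ T →
      ‖Z c (Q (Ioc a c) x) - Z (next π₀.1 c) (Q (Ioc a c) x)‖ ≤
        ε / (‖x‖ + 1) * ‖Q (Ioc a c) x‖ := by
    intro a c hac hcT
    lift c to ℝ≥0 using ne_top_of_le_ne_top ENNReal.coe_ne_top hcT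
    lift a to ℝ≥0 using ne_top_of_le_ne_top ENNReal.coe_ne_top hac
    have hnext := hπ₀ c (ENNReal.coe_le_coe.1 hcT)
    have hnextT := π₀.2.2.2 _ (next_mem π₀.2.2.1 hcT)
    have hcnext := le_next π₀.1 (c : ℝ≥0∞)
    lift next π₀.1 c to ℝ≥0 using ne_top_of_le_ne_top ENNReal.coe_ne_top hnextT with b
    rw [norm_sub_rev]
    exact hmod a c b (ENNReal.coe_le_coe.1 hac) (ENNReal.coe_le_coe.1 hcnext)
      (ENNReal.coe_le_coe.1 hnext) (ENNReal.coe_le_coe.1 hnextT)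
  calc dist (projSum Z Q π.1 x) (projSum Z Q π₀.1 x) ≤ ε / (‖x‖ + 1) * ‖x‖ := by
        rw [dist_eq_norm]
        exact hZ.norm_projSum_sub_le hQ hπ π₀.2.2.1 π.2.2.2 hε'.le x hmesh
    _ ≤ ε := by
        rw [div_mul_eq_mul_div, div_le_iff₀ (by positivity)]
        gcongr
        linarith

theorem exists_strongLim_projSum {D : Set E} (hD : (Submodule.span ℂ D).topologicalClosure = ⊤)
    (hmod : ∀ x ∈ D, IsUniformlyRightContinuous Q Z x) (T : ℝ≥0) :
    ∃ L : E →L[ℂ] E, StrongLim atTop (fun π : Partition (T : ℝ≥0∞) => projSum Z Q π.1) L ∧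
      ∀ x, ‖L x‖ ≤ M * ‖x‖ :=
  exists_strongLim_of_total (fun π x => hZ.norm_projSum_le hQ π.1 x) hD
    fun x hx => hZ.exists_tendsto_projSum hQ (hmod x hx) T

theorem exists_limits_projSum (hZtop : Z ∞ = 0)
    (hQtop : ∀ x, Tendsto (fun T : ℝ≥0 => Q (Ioo (T : ℝ≥0∞) ∞) x) atTop (𝓝 0))
    {D : Set E} (hD : (Submodule.span ℂ D).topologicalClosure = ⊤)
    (hmod : ∀ x ∈ D, IsUniformlyRightContinuous Q Z x) :
    ∃ (Wt : ℝ≥0 → E →L[ℂ] E) (W : E →L[ℂ] E),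
      (∀ T : ℝ≥0, StrongLim atTop (fun π : Partition (T : ℝ≥0∞) => projSum Z Q π.1) (Wt T)) ∧
      StrongLim atTop Wt W ∧ StrongLim atTop (fun π : Partition ∞ => projSum Z Q π.1) W := by
  choose Wt hWt hbound using hZ.exists_strongLim_projSum hQ hD hmod
  have htail : ∀ x, Tendsto (fun T : ℝ≥0 => M * ‖Q (Ioo (T : ℝ≥0∞) ∞) x‖) atTop (𝓝 0) :=
    fun x => by simpa using (hQtop x).norm.const_mul M
  have hconv : ∀ x, ∃ y, Tendsto (fun T => Wt T x) atTop (𝓝 y) := fun x => by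
    refine exists_tendsto_of_eventually_dist_le fun ε hε => ?_
    obtain ⟨T, hT⟩ := ((htail x).eventually_lt_const hε).exists
    refine ⟨Wt T x, ?_⟩
    filter_upwards [eventually_ge_atTop T] with U hTU
    rw [dist_eq_norm]
    exact (hZ.norm_strongLim_projSum_sub_le hQ hZtop (ENNReal.coe_le_coe.2 hTU) (hWt T) (hWt U)
      x).trans hT.le
  obtain ⟨W, hW, -⟩ := exists_strongLim_of_forall_exists_tendsto hbound hconv
  exact ⟨Wt, W, hWt, hW, fun x => hZ.tendsto_projSum_of_strongLim hQ hZtop hWt hW (htail x)⟩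

end IsOrthoIntegrand

end Convergence

section Tensor

variable {A B A' B' A'' B'' : Type*} [NormedAddCommGroup A] [InnerProductSpace ℂ A]
  [NormedAddCommGroup B] [InnerProductSpace ℂ B]
  [NormedAddCommGroup A'] [InnerProductSpace ℂ A']
  [NormedAddCommGroup B'] [InnerProductSpace ℂ B']
  [NormedAddCommGroup A''] [InnerProductSpace ℂ A'']
  [NormedAddCommGroup B''] [InnerProductSpace ℂ B'']

theorem norm_opTensor_apply_le (X : A →L[ℂ] A') (Y : B →L[ℂ] B') (x : HilbertTensor A B) :
    ‖opTensor X Y x‖ ≤ ‖X‖ * ‖Y‖ * ‖x‖ := by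
  refine UniformSpace.Completion.induction_on x
    (isClosed_le (by fun_prop) (by fun_prop)) fun w => ?_
  rw [opTensor, ContinuousLinearMap.completion_apply_coe, UniformSpace.Completion.norm_coe,
    UniformSpace.Completion.norm_coe]
  refine ((TensorProduct.mapL X Y).le_opNorm w).trans ?_
  gcongr
  exact TensorProduct.norm_mapL_le X Y

/-- The map `(a, b) ↦ a ⊗ b` into the Hilbert-space tensor product, as a continuous bilinear
map. -/
def tmulL (A B : Type*) [NormedAddCommGroup A] [InnerProductSpace ℂ A]
    [NormedAddCommGroup B] [InnerProductSpace ℂ B] : A →L[ℂ] B →L[ℂ] HilbertTensor A B :=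
  (ContinuousLinearMap.compL ℂ B (A ⊗[ℂ] B) (HilbertTensor A B)
    UniformSpace.Completion.toComplL).comp (TensorProduct.mkL ℂ A B)

theorem tmulL_apply (a : A) (b : B) : tmulL A B a b = tmul a b := rfl

theorem norm_tmul (a : A) (b : B) : ‖tmul a b‖ = ‖a‖ * ‖b‖ := by
  rw [tmul, UniformSpace.Completion.norm_coe]
  exact TensorProduct.norm_tmul a b

theorem ext_tmul_of_total {ι κ F : Type*} [NormedAddCommGroup F] [NormedSpace ℂ F]
    {a : ι → A} {b : κ → B}
    (ha : (Submodule.span ℂ (range a)).topologicalClosure = ⊤)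
    (hb : (Submodule.span ℂ (range b)).topologicalClosure = ⊤)
    {X Y : HilbertTensor A B →L[ℂ] F} (h : ∀ i j, X (tmul (a i) (b j)) = Y (tmul (a i) (b j))) :
    X = Y := by
  refine ContinuousLinearMap.ext_on
    (Submodule.dense_iff_topologicalClosure_eq_top.2 (tmul_total a b ha hb)) ?_
  rintro _ ⟨⟨i, j⟩, rfl⟩
  exact h i j

theorem ext_tmul {F : Type*} [NormedAddCommGroup F] [NormedSpace ℂ F]
    {X Y : HilbertTensor A B →L[ℂ] F} (h : ∀ a b, X (tmul a b) = Y (tmul a b)) : X = Y :=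
  ext_tmul_of_total (total_univ A) (total_univ B) h

theorem opTensor_comp (X : A →L[ℂ] A') (X' : A' →L[ℂ] A'') (Y : B →L[ℂ] B') (Y' : B' →L[ℂ] B'') :
    opTensor (X' ∘L X) (Y' ∘L Y) = opTensor X' Y' ∘L opTensor X Y :=
  ext_tmul fun a b => by simp [opTensor_tmul]

theorem opTensor_id :
    opTensor (ContinuousLinearMap.id ℂ A) (ContinuousLinearMap.id ℂ B) =
      ContinuousLinearMap.id ℂ _ :=
  ext_tmul fun a b => by simp [opTensor_tmul]

theorem norm_opTensor_apply {X : A →L[ℂ] A'} {Y : B →L[ℂ] B'} (hX : ∀ a, ‖X a‖ = ‖a‖)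
    (hY : ∀ b, ‖Y b‖ = ‖b‖) (x : HilbertTensor A B) : ‖opTensor X Y x‖ = ‖x‖ := by
  refine UniformSpace.Completion.induction_on x
    (isClosed_eq (by fun_prop) (by fun_prop)) fun w => ?_
  rw [opTensor, ContinuousLinearMap.completion_apply_coe, UniformSpace.Completion.norm_coe,
    UniformSpace.Completion.norm_coe, TensorProduct.mapL_apply]
  exact TensorProduct.norm_map ⟨X.toLinearMap, hX⟩ ⟨Y.toLinearMap, hY⟩ w

theorem inner_left_eq_of_total {ι κ E F : Type*} [NormedAddCommGroup E] [InnerProductSpace ℂ E]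
    [NormedAddCommGroup F] [InnerProductSpace ℂ F] [CompleteSpace E] [CompleteSpace F]
    {a : ι → E} {b : κ → F}
    (ha : (Submodule.span ℂ (range a)).topologicalClosure = ⊤)
    (hb : (Submodule.span ℂ (range b)).topologicalClosure = ⊤)
    {X : E →L[ℂ] F} {Y : F →L[ℂ] E} (h : ∀ i j, ⟪X (a i), b j⟫_ℂ = ⟪a i, Y (b j)⟫_ℂ)
    (x : E) (y : F) : ⟪X x, y⟫_ℂ = ⟪x, Y y⟫_ℂ := by
  have hadj : ContinuousLinearMap.adjoint X = Y := by
    refine ContinuousLinearMap.ext_on (Submodule.dense_iff_topologicalClosure_eq_top.2 hb) ?_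
    rintro _ ⟨j, rfl⟩
    refine (Submodule.dense_iff_topologicalClosure_eq_top.2 ha).eq_of_inner_right ℂ fun v hv => ?_
    induction hv using Submodule.span_induction with
    | mem x hx =>
      obtain ⟨i, rfl⟩ := hx
      rw [ContinuousLinearMap.adjoint_inner_right, h]
    | zero => simp
    | add x y _ _ hx hy => rw [inner_add_left, inner_add_left, hx, hy]
    | smul a x _ hx => rw [inner_smul_left, inner_smul_left, hx]
  rw [← hadj, ContinuousLinearMap.adjoint_inner_right]

theorem inner_opTensor_left_eq {X : A →L[ℂ] A'} {Y : B →L[ℂ] B'} {X' : A' →L[ℂ] A}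
    {Y' : B' →L[ℂ] B} (hX : ∀ a b, ⟪X a, b⟫_ℂ = ⟪a, X' b⟫_ℂ)
    (hY : ∀ a b, ⟪Y a, b⟫_ℂ = ⟪a, Y' b⟫_ℂ) (x : HilbertTensor A B) (y : HilbertTensor A' B') :
    ⟪opTensor X Y x, y⟫_ℂ = ⟪x, opTensor X' Y' y⟫_ℂ := by
  refine inner_left_eq_of_total (tmul_total id id (total_univ A) (total_univ B))
    (tmul_total id id (total_univ A') (total_univ B')) (fun i j => ?_) x y
  simp only [id, opTensor_tmul, inner_tmul, hX, hY]

theorem IsProjectionContent.opTensor_id {α : Type*} [MeasurableSpace α] {Q : Set α → B →L[ℂ] B}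
    (hQ : IsProjectionContent Q) :
    IsProjectionContent fun s => opTensor (ContinuousLinearMap.id ℂ A) (Q s) where
  isSymmetricProjection s hs :=
    { isIdempotentElem := by
        refine ContinuousLinearMap.isIdempotentElem_toLinearMap_iff.2 ?_
        change _ ∘L _ = _
        rw [← opTensor_comp, ContinuousLinearMap.id_comp,
          show Q s ∘L Q s = Q s from hQ.isIdempotentElem hs]
      isSymmetric := inner_opTensor_left_eq (fun _ _ => rfl) (hQ.inner_left_eq hs) }
  union s t hs ht h := ext_tmul fun a b => by
    simp only [hQ.union s t hs ht h, opTensor_tmul, add_apply]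
    exact map_add (tmulL A B a) _ _

end Tensor

section SpectralMeasure

theorem iInter_Ioo_natCast_top : ⋂ n : ℕ, Ioo (n : ℝ≥0∞) ∞ = ∅ := by
  refine eq_empty_of_forall_notMem fun s hs => ?_
  rw [mem_iInter] at hs
  obtain ⟨n, hn⟩ := ENNReal.exists_nat_gt (hs 0).2.ne
  exact lt_asymm hn (hs n).1

variable {k : Type*} [NormedAddCommGroup k] [InnerProductSpace ℂ k] (S : QuantumStopTime k)
variable (𝔥 : Type*) [NormedAddCommGroup 𝔥] [InnerProductSpace ℂ 𝔥]

namespace QuantumStopTime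

theorem isProjectionContent_proj : IsProjectionContent S.proj where
  isSymmetricProjection A hA :=
    ContinuousLinearMap.isStarProjection_iff_isSymmetricProjection.1 (S.isStarProjection A hA)
  union A B hA hB h := by
    refine ContinuousLinearMap.ext fun y => ext_inner_left ℂ fun x => ?_
    obtain ⟨μ, hμ⟩ := S.complexMeasure x y
    rw [add_apply, inner_add_right, ← hμ _ hA, ← hμ _ hB, ← hμ _ (hA.union hB),
      μ.of_union h hA hB]

theorem norm_proj_apply_sq {A : Set ℝ≥0∞} (hA : MeasurableSet A) (ξ : FockSpace k) :
    (‖S.proj A ξ‖ ^ 2 : ℂ) = ⟪ξ, S.proj A ξ⟫_ℂ := by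
  have hidem := S.isProjectionContent_proj.apply_apply_of_subset hA hA Subset.rfl ξ
  have h := S.isProjectionContent_proj.inner_left_eq hA ξ (S.proj A ξ)
  rw [hidem] at h
  rw [← h]
  exact (inner_self_eq_norm_sq_to_K (𝕜 := ℂ) (S.proj A ξ)).symm

theorem tendsto_proj_Ioo_top (ξ : FockSpace k) :
    Tendsto (fun T : ℝ≥0 => S.proj (Ioo (T : ℝ≥0∞) ∞) ξ) atTop (𝓝 0) := by
  have hnat : Tendsto (fun n : ℕ => ‖S.proj (Ioo (n : ℝ≥0∞) ∞) ξ‖) atTop (𝓝 0) := by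
    obtain ⟨μ, hμ⟩ := S.complexMeasure ξ ξ
    have h := μ.tendsto_vectorMeasure_iInter_atTop_nat (s := fun n : ℕ => Ioo (n : ℝ≥0∞) ∞)
      (fun m n hmn => Ioo_subset_Ioo_left (by exact_mod_cast hmn)) fun _ => measurableSet_Ioo
    simp only [iInter_Ioo_natCast_top, VectorMeasure.empty, hμ _ measurableSet_Ioo,
      ← S.norm_proj_apply_sq measurableSet_Ioo] at h
    simpa [abs_of_nonneg] using h.norm.sqrt
  refine squeeze_zero_norm (fun T => ?_) (hnat.comp tendsto_nat_floor_atTop)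
  refine S.isProjectionContent_proj.norm_apply_mono measurableSet_Ioo measurableSet_Ioo
    (Ioo_subset_Ioo_left ?_) ξ
  exact_mod_cast Nat.floor_le (zero_le (a := T))

/-- The ampliation of the spectral measure `S` to `𝔥 ⊗ F`. -/
def ampl (A : Set ℝ≥0∞) : Op 𝔥 k :=
  opTensor (ContinuousLinearMap.id ℂ 𝔥) (S.proj A)

theorem ampl_tmul (A : Set ℝ≥0∞) (u : 𝔥) (ξ : FockSpace k) :
    S.ampl 𝔥 A (tmul u ξ) = tmul u (S.proj A ξ) := by
  rw [ampl, opTensor_tmul, ContinuousLinearMap.id_apply]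

theorem isProjectionContent_ampl : IsProjectionContent (S.ampl 𝔥) :=
  S.isProjectionContent_proj.opTensor_id

end QuantumStopTime

theorem total_tmul_expVec : (Submodule.span ℂ (range fun i : 𝔥 × L2 k (Ici 0) =>
    (tmul i.1 (expVec i.2) : HilbertTensor 𝔥 (FockSpace k)))).topologicalClosure = ⊤ :=
  tmul_total id expVec (total_univ 𝔥) expVec_total

theorem QuantumStopTime.tendsto_ampl_Ioo_top (x : HilbertTensor 𝔥 (FockSpace k)) :
    Tendsto (fun T : ℝ≥0 => S.ampl 𝔥 (Ioo (T : ℝ≥0∞) ∞) x) atTop (𝓝 0) := by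
  refine strongLim_of_total (M := 1) (fun T x => ?_) (total_tmul_expVec (k := k) 𝔥) 0 ?_ x
  · rw [one_mul]
    exact (S.isProjectionContent_ampl 𝔥).norm_apply_le measurableSet_Ioo x
  · rintro _ ⟨⟨u, f⟩, rfl⟩
    rw [zero_apply, ← map_zero (tmulL 𝔥 (FockSpace k) u)]
    simp only [S.ampl_tmul]
    exact ((tmulL 𝔥 (FockSpace k) u).continuous.tendsto 0).comp
      (S.tendsto_proj_Ioo_top (expVec f))

end SpectralMeasure

section Shifts

variable {k : Type*} [NormedAddCommGroup k] {A B C : Set ℝ}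

theorem restr_sub (h : A ⊆ C) (f g : L2 k C) : restr h (f - g) = restr h f - restr h g := by
  refine Lp.ext ((restr_ae _).trans ?_)
  filter_upwards [ae_mono (Measure.restrict_mono_set volume h) (Lp.coeFn_sub f g),
    Lp.coeFn_sub (restr h f) (restr h g), restr_ae (h := h) f, restr_ae (h := h) g]
    with s hsub hrestr hf hg
  rw [hsub, hrestr, Pi.sub_apply, Pi.sub_apply, hf, hg]

/-- The left shift `(θ_t^* f)(s) = f(s + t)` on `L²([0, ∞); k)`. -/
def leftShift (t : ℝ≥0) (f : L2 k (Ici 0)) : L2 k (Ici 0) :=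
  Lp.compMeasurePreserving (fun s => s + (t : ℝ)) (measurePreserving_add t)
    (restr (isSplit t).right f)

theorem leftShift_ae (t : ℝ≥0) (f : L2 k (Ici 0)) :
    leftShift t f =ᵐ[volume.restrict (Ici 0)] fun s => f (s + t) :=
  (Lp.coeFn_compMeasurePreserving _ (measurePreserving_add (t : ℝ))).trans
    ((measurePreserving_add (t : ℝ)).quasiMeasurePreserving.ae_eq_comp (restr_ae f))

theorem leftShift_sub (t : ℝ≥0) (f g : L2 k (Ici 0)) :
    leftShift t (f - g) = leftShift t f - leftShift t g := by
  rw [leftShift, restr_sub, map_sub]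
  rfl

theorem leftShift_zero (f : L2 k (Ici 0)) : leftShift 0 f = f := by
  refine Lp.ext ((leftShift_ae 0 f).trans ?_)
  simp

theorem leftShift_add (s t : ℝ≥0) (f : L2 k (Ici 0)) :
    leftShift (s + t) f = leftShift t (leftShift s f) := by
  refine Lp.ext ((leftShift_ae _ _).trans ((leftShift_ae _ _).trans ?_).symm)
  have h : leftShift s f =ᵐ[volume.restrict (Ici (t : ℝ))] fun x => f (x + s) :=
    ae_mono (Measure.restrict_mono_set volume (isSplit t).right) (leftShift_ae s f)
  refine ((measurePreserving_add (t : ℝ)).quasiMeasurePreserving.ae_eq_comp h).trans ?_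
  filter_upwards with x
  simp [add_assoc, add_comm (t : ℝ)]

variable [InnerProductSpace ℂ k]

theorem IsSplit.norm_sq_eq (h : IsSplit A B C) (f : L2 k C) :
    ‖f‖ ^ 2 = ‖restr h.left f‖ ^ 2 + ‖restr h.right f‖ ^ 2 := by
  have := h.inner_eq f f
  simp only [inner_self_eq_norm_sq_to_K] at this
  exact_mod_cast this

theorem IsSplit.ext (h : IsSplit A B C) {f g : L2 k C}
    (hleft : restr h.left f = restr h.left g) (hright : restr h.right f = restr h.right g) :
    f = g := by
  have := h.norm_sq_eq (f - g)
  rw [restr_sub, restr_sub, hleft, hright, sub_self, sub_self] at this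
  simpa [sub_eq_zero] using this

theorem rightShift_leftShift (t : ℝ≥0) (f : L2 k (Ici 0)) :
    rightShift t (leftShift t f) = restr (isSplit t).right f := by
  refine Lp.ext ?_
  have hright := Lp.coeFn_compMeasurePreserving (leftShift t f) (measurePreserving_sub (t : ℝ))
  have hleft :=
    (measurePreserving_sub (t : ℝ)).quasiMeasurePreserving.ae_eq_comp (leftShift_ae t f)
  refine hright.trans (hleft.trans ?_)
  filter_upwards [restr_ae (h := (isSplit t).right) f] with s hs
  simp [hs]

theorem norm_sq_eq_leftShift (t : ℝ≥0) (f : L2 k (Ici 0)) :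
    ‖f‖ ^ 2 = ‖restr (isSplit t).left f‖ ^ 2 + ‖leftShift t f‖ ^ 2 := by
  rw [(isSplit t).norm_sq_eq f, ← rightShift_leftShift, LinearIsometry.norm_map]

theorem norm_leftShift_le (t : ℝ≥0) (f : L2 k (Ici 0)) : ‖leftShift t f‖ ≤ ‖f‖ := by
  refine (sq_le_sq₀ (norm_nonneg _) (norm_nonneg _)).1 ?_
  rw [norm_sq_eq_leftShift t f]
  exact le_add_of_nonneg_left (sq_nonneg _)

theorem norm_restr_left_le (t : ℝ≥0) (f : L2 k (Ici 0)) : ‖restr (isSplit t).left f‖ ≤ ‖f‖ := by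
  refine (sq_le_sq₀ (norm_nonneg _) (norm_nonneg _)).1 ?_
  rw [norm_sq_eq_leftShift t f]
  exact le_add_of_nonneg_right (sq_nonneg _)

theorem norm_sq_restr_left_add (s t : ℝ≥0) (f : L2 k (Ici 0)) :
    ‖restr (isSplit (s + t)).left f‖ ^ 2 =
      ‖restr (isSplit s).left f‖ ^ 2 + ‖restr (isSplit t).left (leftShift s f)‖ ^ 2 := by
  have hst := norm_sq_eq_leftShift (s + t) f
  have hs := norm_sq_eq_leftShift s f
  have ht := norm_sq_eq_leftShift t (leftShift s f)
  rw [leftShift_add] at hst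
  linarith

theorem restr_left_add_ext {s t : ℝ≥0} {f g : L2 k (Ici 0)}
    (hs : restr (isSplit s).left f = restr (isSplit s).left g)
    (ht : restr (isSplit t).left (leftShift s f) = restr (isSplit t).left (leftShift s g)) :
    restr (isSplit (s + t)).left f = restr (isSplit (s + t)).left g := by
  have h := norm_sq_restr_left_add s t (f - g)
  rw [leftShift_sub, restr_sub, restr_sub, restr_sub, hs, ht, sub_self, sub_self] at h
  rwa [norm_zero, norm_zero, zero_pow two_ne_zero, zero_add, sq_eq_zero_iff, norm_eq_zero,
    sub_eq_zero] at h

theorem ext_leftShift {t : ℝ≥0} {f g : L2 k (Ici 0)}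
    (hpast : restr (isSplit t).left f = restr (isSplit t).left g)
    (hfuture : leftShift t f = leftShift t g) : f = g := by
  refine (isSplit t).ext hpast ?_
  rw [← rightShift_leftShift, ← rightShift_leftShift, hfuture]

/-- The function which is `h` on `[0, t)` and the right shift of `g` on `[t, ∞)`. -/
def concat (t : ℝ≥0) (h : L2 k (Ico 0 (t : ℝ))) (g : L2 k (Ici 0)) : L2 k (Ici 0) :=
  ((isSplit t).exists_glue h (rightShift t g)).choose

theorem restr_concat (t : ℝ≥0) (h : L2 k (Ico 0 (t : ℝ))) (g : L2 k (Ici 0)) :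
    restr (isSplit t).left (concat t h g) = h :=
  ((isSplit t).exists_glue h (rightShift t g)).choose_spec.1

theorem restr_right_concat (t : ℝ≥0) (h : L2 k (Ico 0 (t : ℝ))) (g : L2 k (Ici 0)) :
    restr (isSplit t).right (concat t h g) = rightShift t g :=
  ((isSplit t).exists_glue h (rightShift t g)).choose_spec.2

theorem leftShift_concat (t : ℝ≥0) (h : L2 k (Ico 0 (t : ℝ))) (g : L2 k (Ici 0)) :
    leftShift t (concat t h g) = g :=
  (rightShift (k := k) (t : ℝ)).injective (by rw [rightShift_leftShift, restr_right_concat])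

theorem concat_restr_leftShift (t : ℝ≥0) (f : L2 k (Ici 0)) :
    concat t (restr (isSplit t).left f) (leftShift t f) = f :=
  ext_leftShift (restr_concat _ _ _) (leftShift_concat _ _ _)

theorem concat_zero (h : L2 k (Ico 0 ((0 : ℝ≥0) : ℝ))) (g : L2 k (Ici 0)) : concat 0 h g = g := by
  rw [← leftShift_zero (concat 0 h g), leftShift_concat]

theorem concat_add (s t : ℝ≥0) (f g : L2 k (Ici 0)) :
    concat (s + t) (restr (isSplit (s + t)).left f) g =
      concat s (restr (isSplit s).left f)
        (concat t (restr (isSplit t).left (leftShift s f)) g) := by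
  refine ext_leftShift (t := s + t) ?_ ?_
  · rw [restr_concat]
    exact restr_left_add_ext (restr_concat s _ _).symm
      (by rw [leftShift_concat, restr_concat])
  · rw [leftShift_concat, leftShift_add, leftShift_concat, leftShift_concat]

theorem continuous_leftShift (f : L2 k (Ici 0)) : Continuous fun t : ℝ≥0 => leftShift t f := by
  let F : Lp k 2 (volume : Measure ℝ) :=
    ((memLp_indicator_iff_restrict measurableSet_Ici).2 (Lp.memLp f)).toLp ((Ici 0).indicator f)
  have hF : F =ᵐ[volume] (Ici (0 : ℝ)).indicator f := MemLp.coeFn_toLp _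
  have hmp : ∀ t : ℝ≥0, MeasurePreserving (fun s : ℝ => s + (t : ℝ)) volume volume :=
    fun t => measurePreserving_add_right volume (t : ℝ)
  let τ : ℝ≥0 → C(ℝ, ℝ) := fun t => ⟨fun s => s + (t : ℝ), by fun_prop⟩
  have hτ : Continuous τ := by
    refine ContinuousMap.continuous_of_continuous_uncurry _ ?_
    simp only [τ, Function.uncurry_def, ContinuousMap.coe_mk]
    fun_prop
  have hcont : Continuous fun t : ℝ≥0 => Lp.compMeasurePreserving (τ t) (hmp t) F :=
    continuous_const.compMeasurePreservingLp hτ hmp (by simp)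
  have leftShift_eq : ∀ t : ℝ≥0, leftShift t f = LpToLpRestrictCLM ℝ k ℂ volume 2 (Ici 0)
      (Lp.compMeasurePreserving (τ t) (hmp t) F) := by
    intro t
    refine Lp.ext ((leftShift_ae t f).trans ?_)
    refine ((LpToLpRestrictCLM_coeFn (p := 2) (μ := volume) ℂ (Ici (0 : ℝ))
      (Lp.compMeasurePreserving (τ t) (hmp t) F)).trans ?_).symm
    have hFt := (Lp.coeFn_compMeasurePreserving F (hmp t)).trans
      ((hmp t).quasiMeasurePreserving.ae_eq_comp hF)
    filter_upwards [ae_restrict_of_ae hFt, ae_restrict_mem measurableSet_Ici] with s hs hs0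
    have hst : s + (t : ℝ) ∈ Ici (0 : ℝ) := add_nonneg hs0 t.coe_nonneg
    exact hs.trans (indicator_of_mem hst f)
  simp only [leftShift_eq]
  exact (ContinuousLinearMap.continuous _).comp hcont

theorem tendsto_norm_restr_left (f : L2 k (Ici 0)) :
    Tendsto (fun t : ℝ≥0 => ‖restr (isSplit t).left f‖) (𝓝 0) (𝓝 0) := by
  have h : ∀ t : ℝ≥0, ‖restr (isSplit t).left f‖ = √(‖f‖ ^ 2 - ‖leftShift t f‖ ^ 2) := by
    intro t
    rw [norm_sq_eq_leftShift t f, add_sub_cancel_right, Real.sqrt_sq (norm_nonneg _)]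
  simp only [h]
  have := ((((continuous_leftShift f).tendsto 0).norm.pow 2).const_sub (‖f‖ ^ 2)).sqrt
  simpa [leftShift_zero] using this

theorem tendsto_concat (f g : L2 k (Ici 0)) :
    Tendsto (fun t : ℝ≥0 => concat t (restr (isSplit t).left f) g) (𝓝 0) (𝓝 g) := by
  rw [tendsto_iff_norm_sub_tendsto_zero]
  have h : ∀ t : ℝ≥0, ‖concat t (restr (isSplit t).left f) g - g‖ =
      √(‖restr (isSplit t).left (f - g)‖ ^ 2 + ‖g - leftShift t g‖ ^ 2) := by
    intro t
    rw [← Real.sqrt_sq (norm_nonneg (concat t (restr (isSplit t).left f) g - g)),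
      norm_sq_eq_leftShift t, restr_sub, leftShift_sub, restr_concat, leftShift_concat, restr_sub]
  simp only [h]
  have hpast := (tendsto_norm_restr_left (f - g)).pow 2
  have hfuture := (((continuous_leftShift g).tendsto 0).const_sub g).norm.pow 2
  simpa [leftShift_zero] using (hpast.add hfuture).sqrt

end Shifts

section Fock

variable {H : Type*} [NormedAddCommGroup H] [InnerProductSpace ℂ H]

theorem norm_sq_expVec (f : H) : ‖expVec f‖ ^ 2 = Real.exp (‖f‖ ^ 2) := by
  have h := inner_expVec f f
  rw [inner_self_eq_norm_sq_to_K, inner_self_eq_norm_sq_to_K] at h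
  have hcast : ((‖expVec f‖ ^ 2 : ℝ) : ℂ) = ((Real.exp (‖f‖ ^ 2) : ℝ) : ℂ) := by
    push_cast
    exact h
  exact_mod_cast hcast

theorem one_le_norm_expVec (f : H) : 1 ≤ ‖expVec f‖ := by
  refine (sq_le_sq₀ zero_le_one (norm_nonneg _)).1 ?_
  rw [norm_sq_expVec, one_pow]
  exact Real.one_le_exp (sq_nonneg _)

theorem norm_expVec_le {H' : Type*} [NormedAddCommGroup H'] [InnerProductSpace ℂ H'] {f : H}
    {g : H'} (h : ‖f‖ ≤ ‖g‖) : ‖expVec f‖ ≤ ‖expVec g‖ := by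
  refine (sq_le_sq₀ (norm_nonneg _) (norm_nonneg _)).1 ?_
  rw [norm_sq_expVec, norm_sq_expVec]
  gcongr

theorem norm_expVec_zero : ‖expVec (0 : H)‖ = 1 := by
  have := norm_sq_expVec (0 : H)
  rw [norm_zero, zero_pow two_ne_zero, Real.exp_zero] at this
  exact (pow_eq_one_iff_of_nonneg (norm_nonneg _) two_ne_zero).1 this

theorem continuous_expVec : Continuous (expVec : H → Fock H) := by
  rw [continuous_iff_continuousAt]
  intro f
  rw [ContinuousAt, tendsto_iff_norm_sub_tendsto_zero]
  have h : ∀ g : H, ‖expVec g - expVec f‖ =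
      √(Real.exp (‖g‖ ^ 2) - 2 * (Complex.exp ⟪g, f⟫_ℂ).re + Real.exp (‖f‖ ^ 2)) := by
    intro g
    rw [← Real.sqrt_sq (norm_nonneg (expVec g - expVec f)), norm_sub_sq (𝕜 := ℂ), norm_sq_expVec,
      norm_sq_expVec, inner_expVec]
    rfl
  simp only [h]
  have hcont : Continuous fun g : H =>
      √(Real.exp (‖g‖ ^ 2) - 2 * (Complex.exp ⟪g, f⟫_ℂ).re + Real.exp (‖f‖ ^ 2)) := by
    fun_prop
  have hlim := hcont.tendsto f
  rwa [← h f, sub_self, norm_zero] at hlim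

end Fock

section Flow

variable {k : Type*} [NormedAddCommGroup k] [InnerProductSpace ℂ k]
variable {𝔥 : Type*} [NormedAddCommGroup 𝔥] [InnerProductSpace ℂ 𝔥]

theorem op_ext {X Y : Op 𝔥 k}
    (h : ∀ (u : 𝔥) (f : L2 k (Ici 0)), X (tmul u (expVec f)) = Y (tmul u (expVec f))) : X = Y :=
  ext_tmul_of_total (total_univ 𝔥) expVec_total h

theorem continuous_tmul_expVec (u : 𝔥) : Continuous fun f : L2 k (Ici 0) =>
    (tmul u (expVec f) : HilbertTensor 𝔥 (FockSpace k)) :=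
  (tmulL 𝔥 (FockSpace k) u).continuous.comp continuous_expVec

theorem splitRight_tmul_tmul {A B C : Set ℝ} (h : IsSplit A B C) (ξ : Fock (L2 k A)) (u : 𝔥)
    (ζ : Fock (L2 k B)) : splitRight 𝔥 h (tmul ξ (tmul u ζ)) = tmul u (fockSplit h (tmul ξ ζ)) := by
  have heq : (splitRight 𝔥 h).toContinuousLinearEquiv.toContinuousLinearMap ∘L
        opTensor (ContinuousLinearMap.id ℂ (Fock (L2 k A))) (tmulL 𝔥 (Fock (L2 k B)) u) =
      tmulL 𝔥 (Fock (L2 k C)) u ∘L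
        (fockSplit h).toContinuousLinearEquiv.toContinuousLinearMap := by
    refine ext_tmul_of_total expVec_total expVec_total fun f g => ?_
    obtain ⟨F, rfl, rfl⟩ := h.exists_glue f g
    rw [ContinuousLinearMap.comp_apply, opTensor_tmul]
    exact (splitRight_apply 𝔥 h u F).trans (congrArg (tmul u) (fockSplit_apply h F)).symm
  have hξζ := congrArg (· (tmul ξ ζ)) heq
  simp only [ContinuousLinearMap.comp_apply, opTensor_tmul] at hξζ
  exact hξζ

theorem splitLeft_tmul_tmul {A B C : Set ℝ} (h : IsSplit A B C) (u : 𝔥) (ξ : Fock (L2 k A))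
    (ζ : Fock (L2 k B)) : splitLeft 𝔥 h (tmul (tmul u ξ) ζ) = tmul u (fockSplit h (tmul ξ ζ)) := by
  have heq : (splitLeft 𝔥 h).toContinuousLinearEquiv.toContinuousLinearMap ∘L
        opTensor (tmulL 𝔥 (Fock (L2 k A)) u) (ContinuousLinearMap.id ℂ (Fock (L2 k B))) =
      tmulL 𝔥 (Fock (L2 k C)) u ∘L
        (fockSplit h).toContinuousLinearEquiv.toContinuousLinearMap := by
    refine ext_tmul_of_total expVec_total expVec_total fun f g => ?_
    obtain ⟨F, rfl, rfl⟩ := h.exists_glue f g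
    rw [ContinuousLinearMap.comp_apply, opTensor_tmul]
    exact (splitLeft_apply 𝔥 h u F).trans (congrArg (tmul u) (fockSplit_apply h F)).symm
  have hξζ := congrArg (· (tmul ξ ζ)) heq
  simp only [ContinuousLinearMap.comp_apply, opTensor_tmul] at hξζ
  exact hξζ

variable (k 𝔥) in
/-- The ampliation to `𝔥 ⊗ F` of the unitary `Γ_t : F → F_{[t}`. -/
def amplShift (t : ℝ≥0) : HilbertTensor 𝔥 (FockSpace k) →L[ℂ] HilbertTensor 𝔥 (FockFuture k t) :=
  opTensor (ContinuousLinearMap.id ℂ 𝔥) (fockShift (k := k) t : FockSpace k →L[ℂ] FockFuture k t)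

theorem norm_amplShift (t : ℝ≥0) (y : HilbertTensor 𝔥 (FockSpace k)) :
    ‖amplShift k 𝔥 t y‖ = ‖y‖ :=
  norm_opTensor_apply (fun _ => rfl) (fockShift (k := k) t).norm_map y

theorem opTensor_fockShift_symm_amplShift (t : ℝ≥0) (y : HilbertTensor 𝔥 (FockSpace k)) :
    opTensor (ContinuousLinearMap.id ℂ 𝔥)
      ((fockShift (k := k) t).symm : FockFuture k t →L[ℂ] FockSpace k) (amplShift k 𝔥 t y) = y := by
  have hid : opTensor (ContinuousLinearMap.id ℂ 𝔥)
      ((fockShift (k := k) t).symm : FockFuture k t →L[ℂ] FockSpace k) ∘L amplShift k 𝔥 t =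
      ContinuousLinearMap.id ℂ _ :=
    ext_tmul fun u z => by simp [amplShift, opTensor_tmul]
  exact congrArg (· y) hid

variable (𝔥) in
/-- The map `y ↦ ξ ⊗ Γ_t y` of `𝔥 ⊗ F` into `F_{t)} ⊗ (𝔥 ⊗ F_{[t}) ≅ 𝔥 ⊗ F`. It intertwines `X` and
`σ_t(X)`, and is `‖ξ‖` times an isometry. -/
def embed (t : ℝ≥0) (ξ : FockPast k t) : Op 𝔥 k :=
  (splitRight 𝔥 (isSplit t)).toContinuousLinearEquiv.toContinuousLinearMap ∘L
    tmulL (FockPast k t) (HilbertTensor 𝔥 (FockFuture k t)) ξ ∘L amplShift k 𝔥 t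

theorem embed_apply (t : ℝ≥0) (ξ : FockPast k t) (y : HilbertTensor 𝔥 (FockSpace k)) :
    embed 𝔥 t ξ y = splitRight 𝔥 (isSplit t) (tmul ξ (amplShift k 𝔥 t y)) := rfl

theorem norm_embed (t : ℝ≥0) (ξ : FockPast k t) (y : HilbertTensor 𝔥 (FockSpace k)) :
    ‖embed 𝔥 t ξ y‖ = ‖ξ‖ * ‖y‖ := by
  rw [embed_apply, LinearIsometryEquiv.norm_map, norm_tmul, norm_amplShift]

theorem embed_tmul (t : ℝ≥0) (ξ : FockPast k t) (u : 𝔥) (z : FockSpace k) :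
    embed 𝔥 t ξ (tmul u z) = tmul u (fockSplit (isSplit t) (tmul ξ (fockShift t z))) := by
  rw [embed_apply, amplShift, opTensor_tmul, ContinuousLinearMap.id_apply, splitRight_tmul_tmul]
  rfl

theorem embed_tmul_eq_splitLeft (t : ℝ≥0) (ξ : FockPast k t) (u : 𝔥) (z : FockSpace k) :
    embed 𝔥 t ξ (tmul u z) = splitLeft 𝔥 (isSplit t) (tmul (tmul u ξ) (fockShift t z)) := by
  rw [embed_tmul, splitLeft_tmul_tmul]

theorem embed_expVec (t : ℝ≥0) (h : L2 k (Ico 0 (t : ℝ))) (u : 𝔥) (g : L2 k (Ici 0)) :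
    embed 𝔥 t (expVec h) (tmul u (expVec g)) = tmul u (expVec (concat t h g)) := by
  rw [embed_tmul, fockShift_expVec, ← fockSplit_apply (isSplit t) (concat t h g), restr_concat,
    restr_right_concat]

theorem tmul_expVec_eq_embed (t : ℝ≥0) (u : 𝔥) (f : L2 k (Ici 0)) :
    (tmul u (expVec f) : HilbertTensor 𝔥 (FockSpace k)) =
      embed 𝔥 t (expVec (restr (isSplit t).left f)) (tmul u (expVec (leftShift t f))) := by
  rw [embed_expVec, concat_restr_leftShift]

theorem embed_zero (h : L2 k (Ico 0 ((0 : ℝ≥0) : ℝ))) :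
    embed 𝔥 0 (expVec h) = ContinuousLinearMap.id ℂ _ :=
  op_ext fun u g => by rw [embed_expVec, concat_zero, ContinuousLinearMap.id_apply]

theorem embed_add (s t : ℝ≥0) (f : L2 k (Ici 0)) :
    embed 𝔥 (s + t) (expVec (restr (isSplit (s + t)).left f)) =
      embed 𝔥 s (expVec (restr (isSplit s).left f)) ∘L
        embed 𝔥 t (expVec (restr (isSplit t).left (leftShift s f))) :=
  op_ext fun u g => by
    rw [ContinuousLinearMap.comp_apply, embed_expVec, embed_expVec, embed_expVec, concat_add]

theorem norm_embed_restr_le (f : L2 k (Ici 0)) (t : ℝ≥0) (y : HilbertTensor 𝔥 (FockSpace k)) :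
    ‖embed 𝔥 t (expVec (restr (isSplit t).left f)) y‖ ≤ ‖expVec f‖ * ‖y‖ := by
  rw [norm_embed]
  exact mul_le_mul_of_nonneg_right (norm_expVec_le (norm_restr_left_le t f)) (norm_nonneg _)

theorem strongLim_embed (f : L2 k (Ici 0)) :
    StrongLim (𝓝 0) (fun t : ℝ≥0 => embed 𝔥 t (expVec (restr (isSplit t).left f)))
      (ContinuousLinearMap.id ℂ _) := by
  refine strongLim_of_total (norm_embed_restr_le f) (total_tmul_expVec (k := k) 𝔥) _ ?_
  rintro _ ⟨⟨u, g⟩, rfl⟩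
  simp only [embed_expVec, ContinuousLinearMap.id_apply]
  exact ((continuous_tmul_expVec u).tendsto g).comp (tendsto_concat f g)

theorem ccrFlow_embed (t : ℝ≥0) (X : Op 𝔥 k) (ξ : FockPast k t)
    (y : HilbertTensor 𝔥 (FockSpace k)) : ccrFlow t X (embed 𝔥 t ξ y) = embed 𝔥 t ξ (X y) := by
  rw [embed_apply, ccrFlow, LinearIsometryEquiv.conjStarAlgEquiv_apply_apply,
    LinearIsometryEquiv.symm_apply_apply, opTensor_tmul, embed_apply,
    ContinuousLinearMap.comp_apply, ContinuousLinearMap.comp_apply,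
    opTensor_fockShift_symm_amplShift]
  rfl

theorem ccrFlow_tmul_expVec (t : ℝ≥0) (X : Op 𝔥 k) (u : 𝔥) (f : L2 k (Ici 0)) :
    ccrFlow t X (tmul u (expVec f)) =
      embed 𝔥 t (expVec (restr (isSplit t).left f)) (X (tmul u (expVec (leftShift t f)))) := by
  rw [tmul_expVec_eq_embed t u f, ccrFlow_embed]

theorem ccrFlow_comp (t : ℝ≥0) (X Y : Op 𝔥 k) :
    ccrFlow t (X ∘L Y) = ccrFlow t X ∘L ccrFlow t Y :=
  op_ext fun u f => by
    rw [ContinuousLinearMap.comp_apply, ccrFlow_tmul_expVec, ccrFlow_tmul_expVec, ccrFlow_embed]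
    rfl

theorem ccrFlow_sub (t : ℝ≥0) (X Y : Op 𝔥 k) :
    ccrFlow t (X - Y) = ccrFlow t X - ccrFlow t Y :=
  op_ext fun u f => by simp only [sub_apply, ccrFlow_tmul_expVec, map_sub]

theorem ccrFlow_zero (X : Op 𝔥 k) : ccrFlow 0 X = X :=
  op_ext fun u f => by
    rw [ccrFlow_tmul_expVec, embed_zero, leftShift_zero, ContinuousLinearMap.id_apply]

theorem ccrFlow_add (s t : ℝ≥0) (X : Op 𝔥 k) : ccrFlow (s + t) X = ccrFlow s (ccrFlow t X) :=
  op_ext fun u f => by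
    rw [ccrFlow_tmul_expVec, ccrFlow_tmul_expVec, ccrFlow_tmul_expVec, embed_add, leftShift_add,
      ContinuousLinearMap.comp_apply]

theorem norm_ccrFlow_apply_le (t : ℝ≥0) (X : Op 𝔥 k) (x : HilbertTensor 𝔥 (FockSpace k)) :
    ‖ccrFlow t X x‖ ≤ ‖X‖ * ‖x‖ := by
  rw [ccrFlow, LinearIsometryEquiv.conjStarAlgEquiv_apply_apply, LinearIsometryEquiv.norm_map]
  refine (norm_opTensor_apply_le _ _ _).trans ?_
  rw [LinearIsometryEquiv.norm_map]
  refine mul_le_mul_of_nonneg_right ?_ (norm_nonneg _)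
  refine (mul_le_of_le_one_left (norm_nonneg _) ContinuousLinearMap.norm_id_le).trans ?_
  refine ContinuousLinearMap.opNorm_le_bound _ (norm_nonneg X) fun y => ?_
  rw [ContinuousLinearMap.comp_apply, ContinuousLinearMap.comp_apply]
  refine (norm_amplShift t _).trans_le ((X.le_opNorm _).trans ?_)
  exact (congrArg (‖X‖ * ·) (norm_opTensor_apply (fun _ => rfl)
    (Y := ((fockShift (k := k) t).symm : FockFuture k t →L[ℂ] FockSpace k))
    (fockShift (k := k) t).symm.norm_map y)).le

theorem strongLim_ccrFlow (X : Op 𝔥 k) : StrongLim (𝓝 0) (fun t : ℝ≥0 => ccrFlow t X) X := by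
  refine strongLim_of_total (M := ‖X‖) (fun t x => norm_ccrFlow_apply_le t X x)
    (total_tmul_expVec (k := k) 𝔥) _ ?_
  rintro _ ⟨⟨u, f⟩, rfl⟩
  simp only [ccrFlow_tmul_expVec]
  have hX :=
    ((X.continuous.comp (continuous_tmul_expVec u)).comp (continuous_leftShift f)).tendsto 0
  rw [Function.comp_apply, leftShift_zero] at hX
  exact (strongLim_embed f).tendsto_apply (norm_embed_restr_le f) hX

theorem opTensor_pastOp_embed (t : ℝ≥0) (Y : FockPast k t →L[ℂ] FockPast k t) (ξ : FockPast k t)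
    (y : HilbertTensor 𝔥 (FockSpace k)) :
    opTensor (ContinuousLinearMap.id ℂ 𝔥) (pastOp t Y) (embed 𝔥 t ξ y) = embed 𝔥 t (Y ξ) y := by
  have heq : opTensor (ContinuousLinearMap.id ℂ 𝔥) (pastOp t Y) ∘L embed 𝔥 t ξ =
      embed 𝔥 t (Y ξ) := by
    refine ext_tmul fun u z => ?_
    rw [ContinuousLinearMap.comp_apply, embed_tmul, opTensor_tmul, embed_tmul, pastOp,
      LinearIsometryEquiv.conjStarAlgEquiv_apply_apply, LinearIsometryEquiv.symm_apply_apply,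
      opTensor_tmul]
    rfl
  exact congrArg (· y) heq

theorem pastOp_sub (t : ℝ≥0) (Y Z : FockPast k t →L[ℂ] FockPast k t) :
    pastOp t (Y - Z) = pastOp t Y - pastOp t Z :=
  ext_expVec fun f g => by
    simp only [inner_pastOp, sub_apply, inner_sub_right, sub_mul]

theorem smul_id_eq_pastOp (c : ℂ) (t : ℝ≥0) :
    c • ContinuousLinearMap.id ℂ (FockSpace k) =
      pastOp t (c • ContinuousLinearMap.id ℂ (FockPast k t)) :=
  ext_expVec fun f g => by
    simp only [inner_pastOp, smul_apply, ContinuousLinearMap.id_apply, inner_smul_right,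
      inner_expVec]
    rw [mul_assoc, ← Complex.exp_add, (isSplit t).inner_eq]

namespace QuantumStopTime

variable (S : QuantumStopTime k)

theorem exists_proj_Iic_eq_pastOp {a : ℝ≥0∞} {t : ℝ≥0} (h : a ≤ t) :
    ∃ Y : FockPast k t →L[ℂ] FockPast k t, S.proj (Iic a) = pastOp t Y := by
  lift a to ℝ≥0 using ne_top_of_le_ne_top ENNReal.coe_ne_top h
  rcases eq_or_ne a 0 with rfl | ha
  · obtain ⟨c, hc⟩ := S.adapted_zero
    have hIic : Iic ((0 : ℝ≥0) : ℝ≥0∞) = {0} := by ext; simp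
    exact ⟨_, by rw [hIic, hc, smul_id_eq_pastOp c t]⟩
  · obtain ⟨Y, hY⟩ := S.adapted a (pos_iff_ne_zero.2 ha)
    obtain ⟨Z, hZ⟩ := pastOp_mono (ENNReal.coe_le_coe.1 h) Y
    exact ⟨Z, hY.trans hZ⟩

theorem exists_ampl_Ioc_embed {a b : ℝ≥0∞} {t : ℝ≥0} (hab : a ≤ b) (h : b ≤ t) :
    ∃ Y : FockPast k t →L[ℂ] FockPast k t,
      ∀ ξ y, S.ampl 𝔥 (Ioc a b) (embed 𝔥 t ξ y) = embed 𝔥 t (Y ξ) y := by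
  obtain ⟨Y, hY⟩ := S.exists_proj_Iic_eq_pastOp (hab.trans h)
  obtain ⟨Z, hZ⟩ := S.exists_proj_Iic_eq_pastOp h
  refine ⟨Z - Y, fun ξ y => ?_⟩
  rw [ampl, S.isProjectionContent_proj.Ioc_eq_sub hab, hY, hZ, ← pastOp_sub, opTensor_pastOp_embed]

theorem ampl_Iic_ccrFlow {a : ℝ≥0∞} {t : ℝ≥0} (h : a ≤ t) (X : Op 𝔥 k)
    (x : HilbertTensor 𝔥 (FockSpace k)) :
    S.ampl 𝔥 (Iic a) (ccrFlow t X x) = ccrFlow t X (S.ampl 𝔥 (Iic a) x) := by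
  obtain ⟨Y, hY⟩ := S.exists_proj_Iic_eq_pastOp h
  have hcomm : S.ampl 𝔥 (Iic a) ∘L ccrFlow t X = ccrFlow t X ∘L S.ampl 𝔥 (Iic a) :=
    op_ext fun u f => by
      rw [ContinuousLinearMap.comp_apply, ContinuousLinearMap.comp_apply, ccrFlow_tmul_expVec,
        tmul_expVec_eq_embed t u f, ampl, hY, opTensor_pastOp_embed, opTensor_pastOp_embed,
        ccrFlow_embed]
  exact congrArg (· x) hcomm

end QuantumStopTime

end Flow

section Processes

variable {k : Type*} [NormedAddCommGroup k] [InnerProductSpace ℂ k]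
variable {𝔥 : Type*} [NormedAddCommGroup 𝔥] [InnerProductSpace ℂ 𝔥]

/-- A process `Z` with `Z_{b + r} = J_b σ_b(Y_r)`, where the operators `J_b` are isometric and `Y`
is bounded by `M` and strongly continuous at `0`. Such processes can be stopped, and both factors of
the cocycle identity as well as the cocycle itself are of this form. -/
structure IsFlowProcess (Z J Y : ℝ≥0 → Op 𝔥 k) (M : ℝ) : Prop where
  nonneg : 0 ≤ M
  norm_map : ∀ b x, ‖J b x‖ = ‖x‖
  add : ∀ b r, Z (b + r) = J b ∘L ccrFlow b (Y r)
  bound : ∀ r x, ‖Y r x‖ ≤ M * ‖x‖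
  tendsto : StrongLim (𝓝 0) Y (Y 0)

/-- The extension of a process by `0` to the time `∞`. -/
def extendZero (Z : ℝ≥0 → Op 𝔥 k) (b : ℝ≥0∞) : Op 𝔥 k := if b = ∞ then 0 else Z b.toNNReal

theorem extendZero_coe (Z : ℝ≥0 → Op 𝔥 k) (b : ℝ≥0) : extendZero Z b = Z b := by
  simp [extendZero]

theorem extendZero_top (Z : ℝ≥0 → Op 𝔥 k) : extendZero Z ∞ = 0 := by
  simp [extendZero]

namespace IsFlowProcess

variable {Z J Y : ℝ≥0 → Op 𝔥 k} {M : ℝ} (h : IsFlowProcess Z J Y M)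
include h

theorem inner_map (b : ℝ≥0) (x y : HilbertTensor 𝔥 (FockSpace k)) :
    ⟪J b x, J b y⟫_ℂ = ⟪x, y⟫_ℂ :=
  (LinearMap.norm_map_iff_inner_map_map (J b)).1 (h.norm_map b) x y

theorem eq_comp_ccrFlow (b : ℝ≥0) : Z b = J b ∘L ccrFlow b (Y 0) := by
  rw [← h.add, add_zero]

theorem norm_apply_le (b : ℝ≥0) (x : HilbertTensor 𝔥 (FockSpace k)) : ‖Z b x‖ ≤ M * ‖x‖ := by
  have hZ := h.add 0 b
  rw [zero_add, ccrFlow_zero] at hZ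
  rw [hZ, ContinuousLinearMap.comp_apply, h.norm_map]
  exact h.bound b x

theorem inner_ampl_Iic_of_le (S : QuantumStopTime k) {a : ℝ≥0∞} {b c : ℝ≥0} (hab : a ≤ b)
    (hbc : b ≤ c) (x y : HilbertTensor 𝔥 (FockSpace k)) :
    ⟪Z b (S.ampl 𝔥 (Iic a) x), Z c y⟫_ℂ = ⟪Z b x, Z c (S.ampl 𝔥 (Iic a) y)⟫_ℂ := by
  obtain ⟨r, rfl⟩ := exists_add_of_le hbc
  rw [h.eq_comp_ccrFlow b, h.add b r]
  simp only [ContinuousLinearMap.comp_apply, h.inner_map]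
  rw [← S.ampl_Iic_ccrFlow hab, ← S.ampl_Iic_ccrFlow hab,
    (S.isProjectionContent_ampl 𝔥).inner_left_eq measurableSet_Iic]

theorem isOrthoIntegrand (S : QuantumStopTime k) :
    IsOrthoIntegrand (S.ampl 𝔥) (extendZero Z) M where
  nonneg := h.nonneg
  bound b x := by
    induction b with
    | top => simpa [extendZero_top] using mul_nonneg h.nonneg (norm_nonneg x)
    | coe b => rw [extendZero_coe]; exact h.norm_apply_le b x
  ortho a b c hab hac x y := by
    induction b with
    | top => simp [extendZero_top]
    | coe b =>
      induction c with
      | top => simp [extendZero_top]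
      | coe c =>
        rw [extendZero_coe, extendZero_coe]
        rcases le_total b c with hbc | hcb
        · exact h.inner_ampl_Iic_of_le S hab hbc x y
        · rw [← inner_conj_symm, ← h.inner_ampl_Iic_of_le S hac hcb y x, inner_conj_symm]

theorem norm_sub_apply_ampl_Ioc (S : QuantumStopTime k) {a c : ℝ≥0} (hac : a ≤ c) (r : ℝ≥0)
    (u : 𝔥) (f : L2 k (Ici 0)) :
    ‖Z (c + r) (S.ampl 𝔥 (Ioc a c) (tmul u (expVec f))) -
        Z c (S.ampl 𝔥 (Ioc a c) (tmul u (expVec f)))‖ *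
          ‖(tmul u (expVec (leftShift c f)) : HilbertTensor 𝔥 (FockSpace k))‖ =
      ‖Y r (tmul u (expVec (leftShift c f))) - Y 0 (tmul u (expVec (leftShift c f)))‖ *
        ‖S.ampl 𝔥 (Ioc a c) (tmul u (expVec f))‖ := by
  obtain ⟨Q, hQ⟩ := S.exists_ampl_Ioc_embed (𝔥 := 𝔥) (ENNReal.coe_le_coe.2 hac) (le_refl (c : ℝ≥0∞))
  rw [h.add c r, h.eq_comp_ccrFlow c, ContinuousLinearMap.comp_apply,
    ContinuousLinearMap.comp_apply, ← map_sub, h.norm_map, ← sub_apply, ← ccrFlow_sub,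
    tmul_expVec_eq_embed c u f, hQ, ccrFlow_embed, norm_embed, norm_embed, sub_apply]
  ring

theorem isUniformlyRightContinuous (S : QuantumStopTime k) (u : 𝔥) (f : L2 k (Ici 0)) :
    IsUniformlyRightContinuous (S.ampl 𝔥) (extendZero Z) (tmul u (expVec f)) := by
  intro T ε hε
  rcases eq_or_ne u 0 with rfl | hu
  · refine ⟨1, one_pos, fun a c b _ _ _ _ => ?_⟩
    simp [← tmulL_apply]
  have hu_pos : 0 < ‖u‖ := norm_pos_iff.2 hu
  let z : ℝ≥0 → HilbertTensor 𝔥 (FockSpace k) := fun c => tmul u (expVec (leftShift c f))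
  have hz : Continuous z := (continuous_tmul_expVec u).comp (continuous_leftShift f)
  have hz_norm : ∀ c, ‖u‖ ≤ ‖z c‖ := fun c => by
    rw [norm_tmul]
    exact le_mul_of_one_le_right hu_pos.le (one_le_norm_expVec _)
  have hunif := Metric.tendstoUniformlyOn_iff.1
    (h.tendsto.tendstoUniformlyOn h.bound ((isCompact_Icc (a := 0) (b := T)).image hz))
    (ε * ‖u‖) (by positivity)
  obtain ⟨δ, hδ, hball⟩ := Metric.eventually_nhds_iff.1 hunif
  refine ⟨(δ / 2).toNNReal, Real.toNNReal_pos.2 (by positivity), fun a c b hac hcb hbc hbT => ?_⟩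
  obtain ⟨r, rfl⟩ := exists_add_of_le hcb
  have hr : dist r 0 < δ := by
    have := NNReal.coe_le_coe.2 (le_of_add_le_add_left hbc)
    rw [Real.coe_toNNReal _ (by positivity)] at this
    rw [NNReal.dist_eq, NNReal.coe_zero, sub_zero, NNReal.abs_eq]
    linarith
  have hY : ‖Y r (z c) - Y 0 (z c)‖ ≤ ε * ‖z c‖ := by
    rw [← dist_eq_norm, dist_comm]
    exact (hball hr _ ⟨c, ⟨zero_le, hcb.trans hbT⟩, rfl⟩).le.trans (by gcongr; exact hz_norm c)
  rw [extendZero_coe, extendZero_coe]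
  refine le_of_mul_le_mul_right ?_ (hu_pos.trans_le (hz_norm c))
  rw [h.norm_sub_apply_ampl_Ioc S hac, mul_right_comm]
  exact mul_le_mul_of_nonneg_right hY (norm_nonneg _)

theorem exists_limits_projSum (S : QuantumStopTime k) :
    ∃ (Wt : ℝ≥0 → Op 𝔥 k) (W : Op 𝔥 k),
      (∀ T : ℝ≥0, StrongLim atTop
        (fun π : Partition (T : ℝ≥0∞) => projSum (extendZero Z) (S.ampl 𝔥) π.1) (Wt T)) ∧
      StrongLim atTop Wt W ∧
      StrongLim atTop (fun π : Partition ∞ => projSum (extendZero Z) (S.ampl 𝔥) π.1) W := by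
  refine (h.isOrthoIntegrand S).exists_limits_projSum (S.isProjectionContent_ampl 𝔥)
    (extendZero_top Z) (S.tendsto_ampl_Ioo_top 𝔥) (total_tmul_expVec (k := k) 𝔥) ?_
  rintro _ ⟨⟨u, f⟩, rfl⟩
  exact h.isUniformlyRightContinuous S u f

end IsFlowProcess

end Processes

section ReplaceFuture

variable {k : Type*} [NormedAddCommGroup k] [InnerProductSpace ℂ k]
variable {𝔥 : Type*} [NormedAddCommGroup 𝔥] [InnerProductSpace ℂ 𝔥]

theorem pastFuture_apply (t : ℝ≥0)
    (A : HilbertTensor 𝔥 (FockPast k t) →L[ℂ] HilbertTensor 𝔥 (FockPast k t))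
    (B : FockFuture k t →L[ℂ] FockFuture k t)
    (y : HilbertTensor 𝔥 (FockPast k t)) (η : FockFuture k t) :
    pastFuture t A B (splitLeft 𝔥 (isSplit t) (tmul y η)) =
      splitLeft 𝔥 (isSplit t) (tmul (A y) (B η)) := by
  rw [pastFuture, LinearIsometryEquiv.conjStarAlgEquiv_apply_apply,
    LinearIsometryEquiv.symm_apply_apply, opTensor_tmul]

theorem pastFuture_comp (t : ℝ≥0)
    (A A' : HilbertTensor 𝔥 (FockPast k t) →L[ℂ] HilbertTensor 𝔥 (FockPast k t))
    (B B' : FockFuture k t →L[ℂ] FockFuture k t) :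
    pastFuture t A B ∘L pastFuture t A' B' = pastFuture t (A ∘L A') (B ∘L B') := by
  ext x
  simp only [pastFuture, ContinuousLinearMap.comp_apply,
    LinearIsometryEquiv.conjStarAlgEquiv_apply_apply, LinearIsometryEquiv.symm_apply_apply,
    opTensor_comp]

theorem norm_pastFuture_apply_le (t : ℝ≥0)
    (A : HilbertTensor 𝔥 (FockPast k t) →L[ℂ] HilbertTensor 𝔥 (FockPast k t))
    (B : FockFuture k t →L[ℂ] FockFuture k t) (x : HilbertTensor 𝔥 (FockSpace k)) :
    ‖pastFuture t A B x‖ ≤ ‖A‖ * ‖B‖ * ‖x‖ := by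
  rw [pastFuture, LinearIsometryEquiv.conjStarAlgEquiv_apply_apply, LinearIsometryEquiv.norm_map]
  refine (norm_opTensor_apply_le _ _ _).trans ?_
  rw [LinearIsometryEquiv.norm_map]

theorem ccrFlow_opTensor_id (t : ℝ≥0) (X : FockSpace k →L[ℂ] FockSpace k) :
    ccrFlow t (opTensor (ContinuousLinearMap.id ℂ 𝔥) X) =
      pastFuture t (ContinuousLinearMap.id ℂ _)
        ((fockShift (k := k) (t : ℝ) : FockSpace k →L[ℂ] FockFuture k t) ∘L X ∘L
          ((fockShift (k := k) (t : ℝ)).symm : FockFuture k t →L[ℂ] FockSpace k)) :=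
  op_ext fun u f => by
    rw [tmul_expVec_eq_embed t u f, ccrFlow_embed, opTensor_tmul, embed_tmul_eq_splitLeft,
      embed_tmul_eq_splitLeft, pastFuture_apply]
    simp

theorem pastFuture_comp_ccrFlow (t : ℝ≥0)
    (A : HilbertTensor 𝔥 (FockPast k t) →L[ℂ] HilbertTensor 𝔥 (FockPast k t))
    (X : FockSpace k →L[ℂ] FockSpace k) :
    pastFuture t A (ContinuousLinearMap.id ℂ _) ∘L
        ccrFlow t (opTensor (ContinuousLinearMap.id ℂ 𝔥) X) =
      ccrFlow t (opTensor (ContinuousLinearMap.id ℂ 𝔥) X) ∘L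
        pastFuture t A (ContinuousLinearMap.id ℂ _) := by
  rw [ccrFlow_opTensor_id, pastFuture_comp, pastFuture_comp]
  rfl

/-- The operator `ξ ↦ ⟪ε(0), ξ⟫ ε(g)`, which maps every exponential vector to `ε(g)`. -/
def vacuumTo (g : L2 k (Ici 0)) : FockSpace k →L[ℂ] FockSpace k :=
  (innerSL ℂ (expVec (0 : L2 k (Ici 0)))).smulRight (expVec g)

theorem vacuumTo_expVec (f g : L2 k (Ici 0)) : vacuumTo g (expVec f) = expVec g := by
  simp [vacuumTo, inner_expVec]

theorem norm_vacuumTo_le (g : L2 k (Ici 0)) : ‖vacuumTo g‖ ≤ ‖expVec g‖ := by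
  rw [vacuumTo, ContinuousLinearMap.norm_smulRight_apply, innerSL_apply_norm, norm_expVec_zero,
    one_mul]

variable (𝔥) in
/-- The operator on `𝔥 ⊗ F` which replaces the future of an exponential vector after the time `t`
by the right shift of `g`. Applied to the vectors with `f = 0` on `[t, ∞)`, these operators produce
a total set. -/
def replaceFuture (t : ℝ≥0) (g : L2 k (Ici 0)) : Op 𝔥 k :=
  ccrFlow t (opTensor (ContinuousLinearMap.id ℂ 𝔥) (vacuumTo g))

theorem replaceFuture_tmul (t : ℝ≥0) (g : L2 k (Ici 0)) (u : 𝔥) (f : L2 k (Ici 0)) :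
    replaceFuture 𝔥 t g (tmul u (expVec f)) =
      tmul u (expVec (concat t (restr (isSplit t).left f) g)) := by
  rw [replaceFuture, ccrFlow_tmul_expVec, opTensor_tmul, vacuumTo_expVec,
    ContinuousLinearMap.id_apply, embed_expVec]

theorem replaceFuture_add (s t : ℝ≥0) (g : L2 k (Ici 0)) :
    replaceFuture 𝔥 (s + t) g = ccrFlow s (replaceFuture 𝔥 t g) := ccrFlow_add _ _ _

theorem replaceFuture_leftShift_concat_zero (t : ℝ≥0) (u : 𝔥) (f : L2 k (Ici 0)) :
    replaceFuture 𝔥 t (leftShift t f)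
        (tmul u (expVec (concat t (restr (isSplit t).left f) 0))) = tmul u (expVec f) := by
  rw [replaceFuture_tmul, restr_concat, concat_restr_leftShift]

theorem norm_replaceFuture_apply_le (t : ℝ≥0) (g : L2 k (Ici 0))
    (x : HilbertTensor 𝔥 (FockSpace k)) : ‖replaceFuture 𝔥 t g x‖ ≤ ‖expVec g‖ * ‖x‖ := by
  refine (norm_ccrFlow_apply_le _ _ _).trans (mul_le_mul_of_nonneg_right ?_ (norm_nonneg _))
  refine ContinuousLinearMap.opNorm_le_bound _ (norm_nonneg _) fun y => ?_
  refine (norm_opTensor_apply_le _ _ _).trans (mul_le_mul_of_nonneg_right ?_ (norm_nonneg _))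
  exact (mul_le_of_le_one_left (norm_nonneg _) ContinuousLinearMap.norm_id_le).trans
    (norm_vacuumTo_le g)

theorem exists_replaceFuture_eq_opTensor_id (t : ℝ≥0) (g : L2 k (Ici 0)) :
    ∃ X : FockSpace k →L[ℂ] FockSpace k,
      replaceFuture 𝔥 t g = opTensor (ContinuousLinearMap.id ℂ 𝔥) X := by
  refine ⟨(fockSplit (isSplit t)).conjStarAlgEquiv (opTensor (ContinuousLinearMap.id ℂ _)
    ((innerSL ℂ (expVec (0 : L2 k (Ici (t : ℝ))))).smulRight (expVec (rightShift (t : ℝ) g)))),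
    op_ext fun u f => ?_⟩
  have hsplit := fockSplit_apply (isSplit t) (concat t (restr (isSplit t).left f) g)
  rw [restr_concat, restr_right_concat] at hsplit
  rw [replaceFuture_tmul, opTensor_tmul, LinearIsometryEquiv.conjStarAlgEquiv_apply_apply,
    fockSplit_symm_apply, opTensor_tmul]
  simp [inner_expVec, hsplit]

theorem ext_of_comp_replaceFuture {t : ℝ≥0} {X Y : Op 𝔥 k}
    (hX : ∀ g, X ∘L replaceFuture 𝔥 t g = replaceFuture 𝔥 t g ∘L X)
    (hY : ∀ g, Y ∘L replaceFuture 𝔥 t g = replaceFuture 𝔥 t g ∘L Y)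
    (h : ∀ (u : 𝔥) (f : L2 k (Ici 0)), leftShift t f = 0 →
      X (tmul u (expVec f)) = Y (tmul u (expVec f))) : X = Y :=
  op_ext fun u f => by
    rw [← replaceFuture_leftShift_concat_zero t u f, ← ContinuousLinearMap.comp_apply, hX,
      ← ContinuousLinearMap.comp_apply, hY, ContinuousLinearMap.comp_apply,
      h _ _ (leftShift_concat _ _ _), ContinuousLinearMap.comp_apply]

end ReplaceFuture

section Cocycles

variable {k : Type*} [NormedAddCommGroup k] [InnerProductSpace ℂ k]
variable {𝔥 : Type*} [NormedAddCommGroup 𝔥] [InnerProductSpace ℂ 𝔥]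

namespace AdaptedProcess

variable [CompleteSpace 𝔥] {𝒜 : VonNeumannAlgebra 𝔥} {p : k →L[ℂ] k} {V : AdaptedProcess 𝒜 p}

theorem hat_comp_replaceFuture (t : ℝ≥0) (g : L2 k (Ici 0)) :
    V.hat t ∘L replaceFuture 𝔥 t g = replaceFuture 𝔥 t g ∘L V.hat t :=
  pastFuture_comp_ccrFlow _ _ _

theorem hat_comp_replaceFuture_add (s t : ℝ≥0) (g : L2 k (Ici 0)) :
    V.hat s ∘L replaceFuture 𝔥 (s + t) g = replaceFuture 𝔥 (s + t) g ∘L V.hat s := by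
  obtain ⟨X, hX⟩ := exists_replaceFuture_eq_opTensor_id (𝔥 := 𝔥) t g
  rw [replaceFuture_add, hX]
  exact pastFuture_comp_ccrFlow _ _ _

theorem op_apply_eq_hat_apply [CompleteSpace k] (hp : IsStarProjection p) {t : ℝ≥0}
    {f : L2 k (Ici 0)} (hf : leftShift t f = 0) (u : 𝔥) :
    V.op t (tmul u (expVec f)) = V.hat t (tmul u (expVec f)) := by
  rw [V.op_eq t, hat, tmul_expVec_eq_embed t u f, embed_tmul_eq_splitLeft, pastFuture_apply,
    pastFuture_apply, hf, fockShift_expVec, map_zero, futureProj_expVec hp, map_zero,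
    ContinuousLinearMap.id_apply]

theorem norm_hat_apply_sub_le [CompleteSpace k] (hp : IsStarProjection p) (t : ℝ≥0) (u : 𝔥)
    (f : L2 k (Ici 0)) :
    ‖V.hat t (tmul u (expVec f)) - tmul u (expVec f)‖ ≤ ‖expVec f‖ *
      ‖V.op t (tmul u (expVec (concat t (restr (isSplit t).left f) 0))) -
        tmul u (expVec (concat t (restr (isSplit t).left f) 0))‖ := by
  rw [op_apply_eq_hat_apply hp (leftShift_concat _ _ _)]
  conv_lhs => rw [← replaceFuture_leftShift_concat_zero t u f, ← ContinuousLinearMap.comp_apply,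
    hat_comp_replaceFuture, ContinuousLinearMap.comp_apply, ← map_sub]
  exact (norm_replaceFuture_apply_le _ _ _).trans
    (mul_le_mul_of_nonneg_right (norm_expVec_le (norm_leftShift_le t f)) (norm_nonneg _))

namespace IsIsometric

variable (hV : V.IsIsometric)
include hV

theorem norm_past_apply (t : ℝ≥0) (y : HilbertTensor 𝔥 (FockPast k t)) : ‖V.past t y‖ = ‖y‖ :=
  (ContinuousLinearMap.norm_map_iff_adjoint_comp_self _).2 (hV t) y

theorem norm_hat_apply (t : ℝ≥0) (x : HilbertTensor 𝔥 (FockSpace k)) : ‖V.hat t x‖ = ‖x‖ := by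
  rw [hat, pastFuture, LinearIsometryEquiv.conjStarAlgEquiv_apply_apply,
    LinearIsometryEquiv.norm_map, norm_opTensor_apply (hV.norm_past_apply t) fun _ => rfl,
    LinearIsometryEquiv.norm_map]

theorem norm_op_apply_le (t : ℝ≥0) (x : HilbertTensor 𝔥 (FockSpace k)) : ‖V.op t x‖ ≤ ‖x‖ := by
  rw [V.op_eq t]
  refine (norm_pastFuture_apply_le _ _ _ _).trans (mul_le_of_le_one_left (norm_nonneg _) ?_)
  refine mul_le_one₀ ?_ (norm_nonneg _) (Submodule.starProjection_norm_le _)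
  refine ContinuousLinearMap.opNorm_le_bound _ zero_le_one fun y => ?_
  rw [hV.norm_past_apply, one_mul]

theorem injective_hat (t : ℝ≥0) : Function.Injective (V.hat t) :=
  (AddMonoidHomClass.isometry_of_norm _ (hV.norm_hat_apply t)).injective

end IsIsometric

namespace IsCocycle

variable (hV : V.IsCocycle)
include hV

theorem isFlowProcess_op (hiso : V.IsIsometric)
    (hcont : ∀ z, ContinuousAt (fun t => V.op t z) 0) : IsFlowProcess V.op V.hat V.op 1 where
  nonneg := zero_le_one
  norm_map := hiso.norm_hat_apply
  add := hV
  bound r x := by rw [one_mul]; exact hiso.norm_op_apply_le r x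
  tendsto := hcont

variable [CompleteSpace k] (hp : IsStarProjection p)
include hp

theorem hat_add (s t : ℝ≥0) : V.hat (s + t) = V.hat s ∘L ccrFlow s (V.hat t) := by
  refine ext_of_comp_replaceFuture (t := s + t) (hat_comp_replaceFuture _) (fun g => ?_)
    fun u f hf => ?_
  · have hflow : ccrFlow s (V.hat t) ∘L replaceFuture 𝔥 (s + t) g =
        replaceFuture 𝔥 (s + t) g ∘L ccrFlow s (V.hat t) := by
      rw [replaceFuture_add, ← ccrFlow_comp, ← ccrFlow_comp, hat_comp_replaceFuture]
    rw [ContinuousLinearMap.comp_assoc, hflow, ← ContinuousLinearMap.comp_assoc,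
      hat_comp_replaceFuture_add, ContinuousLinearMap.comp_assoc]
  · rw [← op_apply_eq_hat_apply hp hf, hV s t, ContinuousLinearMap.comp_apply,
      ContinuousLinearMap.comp_apply, ccrFlow_tmul_expVec, ccrFlow_tmul_expVec,
      op_apply_eq_hat_apply hp (by rw [← leftShift_add, hf])]

variable (hiso : V.IsIsometric)
include hiso

theorem hat_zero : V.hat 0 = ContinuousLinearMap.id ℂ _ := by
  have hidem := hV.hat_add hp 0 0
  rw [add_zero, ccrFlow_zero] at hidem
  exact ContinuousLinearMap.ext fun x => (hiso.injective_hat 0 (congrArg (· x) hidem)).symm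

theorem op_zero_vacuum (u : 𝔥) :
    V.op 0 (tmul u (expVec 0)) = tmul u (expVec (0 : L2 k (Ici 0))) := by
  rw [op_apply_eq_hat_apply hp (leftShift_zero 0), hV.hat_zero hp hiso,
    ContinuousLinearMap.id_apply]

variable (hcont : ∀ z, ContinuousAt (fun t => V.op t z) 0)
include hcont

theorem strongLim_hat : StrongLim (𝓝 0) V.hat (ContinuousLinearMap.id ℂ _) := by
  refine strongLim_of_total (M := 1) (fun t x => by rw [hiso.norm_hat_apply, one_mul])
    (total_tmul_expVec (k := k) 𝔥) _ ?_
  rintro _ ⟨⟨u, f⟩, rfl⟩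
  have htrunc : Tendsto (fun t : ℝ≥0 => (tmul u (expVec (concat t (restr (isSplit t).left f) 0)) :
      HilbertTensor 𝔥 (FockSpace k))) (𝓝 0) (𝓝 (tmul u (expVec 0))) :=
    ((continuous_tmul_expVec u).tendsto 0).comp (tendsto_concat f 0)
  have hop := StrongLim.tendsto_apply (L := V.op 0) (M := 1)
    (fun t x => by rw [one_mul]; exact hiso.norm_op_apply_le t x) hcont htrunc
  have hbound := ((hop.sub htrunc).norm).const_mul ‖expVec f‖
  rw [hV.op_zero_vacuum hp hiso, sub_self, norm_zero, mul_zero] at hbound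
  exact tendsto_iff_norm_sub_tendsto_zero.2
    (squeeze_zero (fun _ => norm_nonneg _) (fun t => norm_hat_apply_sub_le hp t u f) hbound)

theorem isFlowProcess_hat : IsFlowProcess V.hat V.hat V.hat 1 where
  nonneg := zero_le_one
  norm_map := hiso.norm_hat_apply
  add := hV.hat_add hp
  bound r x := by rw [one_mul, hiso.norm_hat_apply]
  tendsto := by
    rw [hV.hat_zero hp hiso]
    exact hV.strongLim_hat hp hiso hcont

end IsCocycle

end AdaptedProcess

theorem isFlowProcess_ccrFlow (X : Op 𝔥 k) :
    IsFlowProcess (fun t => ccrFlow t X) (fun _ => ContinuousLinearMap.id ℂ _)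
      (fun t => ccrFlow t X) ‖X‖ where
  nonneg := norm_nonneg X
  norm_map _ _ := rfl
  add b r := by rw [ccrFlow_add, ContinuousLinearMap.id_comp]
  bound r x := norm_ccrFlow_apply_le r X x
  tendsto := by
    rw [ccrFlow_zero]
    exact strongLim_ccrFlow X

end Cocycles

section Stopping

theorem projSum_comp_projSum {E : Type*} [NormedAddCommGroup E] [InnerProductSpace ℂ E]
    {Q : Set ℝ≥0∞ → E →L[ℂ] E} (hQ : IsProjectionContent Q) (J : ℝ≥0∞ → E →L[ℂ] E)
    {Z : ℝ≥0∞ → E →L[ℂ] E} (hZ : ∀ a b, a ≤ b → Commute (Z b) (Q (Iic a))) (π : Finset ℝ≥0∞) :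
    projSum J Q π ∘L projSum Z Q π = projSum (fun b => J b ∘L Z b) Q π := by
  have hcomm (b : ℝ≥0∞) (x : E) :
      Z b (Q (Ioc (pred π b) b) x) = Q (Ioc (pred π b) b) (Z b x) := by
    rw [hQ.Ioc_eq_sub (pred_le π b)]
    exact DFunLike.congr_fun ((hZ b b le_rfl).sub_right (hZ _ b (pred_le π b))).eq x
  ext x
  rw [ContinuousLinearMap.comp_apply, projSum_apply, projSum_apply, projSum_apply]
  refine Finset.sum_congr rfl fun b hb => ?_
  rw [map_sum, Finset.sum_eq_single_of_mem b hb, ContinuousLinearMap.comp_apply, hcomm,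
    hQ.apply_apply_of_subset measurableSet_Ioc measurableSet_Ioc subset_rfl]
  intro c hc hcb
  rw [hcomm, hQ.apply_apply_of_disjoint measurableSet_Ioc measurableSet_Ioc
    (pairwiseDisjoint_Ioc_pred π (Finset.mem_filter.1 hb).1 (Finset.mem_filter.1 hc).1 hcb.symm)]

/-- The partition of `[0, ∞]` obtained by translating a partition by `-t`, where the points of
`[0, t]` are mapped to `0`. -/
def shiftPartition (t : ℝ≥0) (π : Partition ∞) : Partition ∞ :=
  ⟨π.1.image (· - (t : ℝ≥0∞)), Finset.mem_image.2 ⟨0, π.2.1, by simp⟩,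
    Finset.mem_image.2 ⟨∞, π.2.2.1, by simp⟩, fun _ _ => le_top⟩

theorem tendsto_shiftPartition (t : ℝ≥0) : Tendsto (shiftPartition t) atTop atTop := by
  refine tendsto_atTop.2 fun π₀ => ?_
  let π₁ : Partition ∞ := ⟨insert 0 (π₀.1.image (· + (t : ℝ≥0∞))), by simp,
    Finset.mem_insert_of_mem (Finset.mem_image.2 ⟨∞, π₀.2.2.1, by simp⟩), fun _ _ => le_top⟩
  filter_upwards [eventually_ge_atTop π₁] with π hπ x hx
  refine Finset.mem_image.2 ⟨x + t, hπ ?_, ENNReal.add_sub_cancel_right ENNReal.coe_ne_top⟩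
  exact Finset.mem_insert_of_mem (Finset.mem_image_of_mem _ hx)

theorem preimage_add_Ioc_pred {t : ℝ≥0} {π : Finset ℝ≥0∞} (ht : (t : ℝ≥0∞) ∈ π) {b : ℝ≥0∞}
    (hb : (t : ℝ≥0∞) < b) :
    (fun s : ℝ≥0∞ => s + (t : ℝ≥0∞)) ⁻¹' Ioc (pred π b) b =
      Ioc (pred (π.image (· - (t : ℝ≥0∞))) (b - t)) (b - t) := by
  have ht_top : (t : ℝ≥0∞) ≠ ∞ := ENNReal.coe_ne_top
  ext s
  rw [mem_preimage, mem_Ioc, mem_Ioc, ENNReal.le_sub_iff_add_le_right ht_top hb.le]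
  refine and_congr_left fun _ => ?_
  rcases eq_or_ne s 0 with rfl | hs
  · rw [zero_add]
    exact iff_of_false (le_pred ht hb).not_gt not_lt_zero
  have hs_pos : 0 < s := pos_iff_ne_zero.2 hs
  rw [pred_lt_iff (hs_pos.trans_le le_self_add), pred_lt_iff hs_pos]
  simp only [Finset.mem_image, forall_exists_index, and_imp, forall_apply_eq_imp_iff₂]
  refine forall₂_congr fun y _ => ?_
  rcases le_or_gt y t with hy | hy
  · rw [tsub_eq_zero_of_le hy]
    exact iff_of_true (fun _ => hy.trans_lt (add_comm s t ▸ ENNReal.lt_add_right ht_top hs))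
      fun _ => hs_pos
  · rw [lt_tsub_iff_right, tsub_add_cancel_of_le hy.le, ENNReal.sub_lt_iff_lt_right ht_top hy.le]

variable {k : Type*} [NormedAddCommGroup k] [InnerProductSpace ℂ k]
variable {𝔥 : Type*} [NormedAddCommGroup 𝔥] [InnerProductSpace ℂ 𝔥]

theorem riemannSum_eq_projSum (V : ℝ≥0 → Op 𝔥 k) (S : QuantumStopTime k) {T : ℝ≥0}
    (π : Partition (T : ℝ≥0∞)) :
    riemannSum (fun b => V b.toNNReal) S π.1 = projSum (extendZero V) (S.ampl 𝔥) π.1 := by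
  refine Finset.sum_congr rfl fun b hb => ?_
  have hb_top : b ≠ ∞ :=
    ne_top_of_le_ne_top ENNReal.coe_ne_top (π.2.2.2 b (Finset.mem_filter.1 hb).1)
  rw [extendZero, if_neg hb_top, QuantumStopTime.ampl]

theorem riemannSum_ccrFlowExt (X : Op 𝔥 k) (S : QuantumStopTime k) (π : Partition ∞) :
    riemannSum (fun b => ccrFlowExt b X) S π.1 =
      projSum (extendZero fun t => ccrFlow t X) (S.ampl 𝔥) π.1 +
        S.ampl 𝔥 (Ioc (pred π.1 ∞) ∞) := by
  have hmem : ∞ ∈ π.1.filter (0 < ·) := Finset.mem_filter.2 ⟨π.2.2.1, ENNReal.zero_lt_top⟩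
  rw [riemannSum, projSum, ← Finset.sum_erase_add _ _ hmem, ← Finset.sum_erase_add _ _ hmem,
    extendZero_top, ContinuousLinearMap.zero_comp, add_zero, ccrFlowExt, if_pos rfl,
    ContinuousLinearMap.id_comp, QuantumStopTime.ampl]
  congr 1
  refine Finset.sum_congr rfl fun b hb => ?_
  have hb_top : b ≠ ∞ := Finset.ne_of_mem_erase hb
  rw [extendZero, if_neg hb_top, ccrFlowExt, if_neg hb_top, QuantumStopTime.ampl]

theorem strongLim_ampl_Ioc_pred_top (S : QuantumStopTime k) :
    StrongLim atTop (fun π : Partition ∞ => S.ampl 𝔥 (Ioc (pred π.1 ∞) ∞)) (S.ampl 𝔥 {∞}) := by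
  intro x
  have hQ := S.isProjectionContent_ampl 𝔥
  have hIoc : ∀ π : Partition ∞, S.ampl 𝔥 (Ioc (pred π.1 ∞) ∞) x - S.ampl 𝔥 {∞} x =
      S.ampl 𝔥 (Ioo (pred π.1 ∞) ∞) x := by
    intro π
    have hlt : pred π.1 ∞ < ∞ := (pred_lt_iff ENNReal.zero_lt_top).2 fun _ _ => id
    rw [← Ioo_union_right hlt, hQ.union _ _ measurableSet_Ioo (measurableSet_singleton _)
      (by simp), add_apply, add_sub_cancel_right]
  refine tendsto_sub_nhds_zero_iff.1 (Metric.tendsto_nhds.2 fun ε hε => ?_)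
  obtain ⟨T, hT⟩ := (Metric.tendsto_nhds.1 (S.tendsto_ampl_Ioo_top 𝔥 x) ε hε).exists
  filter_upwards [eventually_mem_partition (U := ∞) (T := (T : ℝ≥0∞)) le_top] with π hπ
  rw [dist_zero_right] at hT ⊢
  rw [hIoc]
  exact (hQ.norm_apply_mono measurableSet_Ioo measurableSet_Ioo
    (Ioo_subset_Ioo_left (le_pred hπ ENNReal.coe_lt_top)) x).trans_lt hT

theorem projSum_extendZero_comp_ampl_top (Z : ℝ≥0 → Op 𝔥 k) (S : QuantumStopTime k)
    (π : Finset ℝ≥0∞) : projSum (extendZero Z) (S.ampl 𝔥) π ∘L S.ampl 𝔥 {∞} = 0 := by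
  ext x
  rw [ContinuousLinearMap.comp_apply, projSum_apply]
  refine Finset.sum_eq_zero fun b _ => ?_
  rcases eq_or_ne b ∞ with rfl | hb
  · rw [extendZero_top, zero_apply]
  · rw [(S.isProjectionContent_ampl 𝔥).apply_apply_of_disjoint measurableSet_Ioc
      (measurableSet_singleton _) (by simp [hb]), map_zero]

theorem comp_ampl_top_of_strongLim {Z : ℝ≥0 → Op 𝔥 k} {S : QuantumStopTime k} {W : Op 𝔥 k}
    (hW : StrongLim atTop (fun π : Partition ∞ => projSum (extendZero Z) (S.ampl 𝔥) π.1) W) :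
    W ∘L S.ampl 𝔥 {∞} = 0 := by
  refine StrongLim.unique (l := (atTop : Filter (Partition ∞))) (T := fun _ => 0)
    (fun x => (hW (S.ampl 𝔥 {∞} x)).congr fun π => ?_) fun _ => tendsto_const_nhds
  exact DFunLike.congr_fun (projSum_extendZero_comp_ampl_top Z S π.1) x

theorem commute_extendZero_ccrFlow_ampl_Iic (X : Op 𝔥 k) (S : QuantumStopTime k) {a b : ℝ≥0∞}
    (hab : a ≤ b) : Commute (extendZero (fun t => ccrFlow t X) b) (S.ampl 𝔥 (Iic a)) := by
  induction b with
  | top => rw [extendZero_top]; exact .zero_left _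
  | coe b =>
    rw [extendZero_coe]
    exact ContinuousLinearMap.ext fun x => (S.ampl_Iic_ccrFlow hab X x).symm

theorem ampl_addTime_Ioc_eq_zero {S : QuantumStopTime k} (hS : S.proj {0} = 0) {t : ℝ≥0}
    (a : ℝ≥0∞) {b : ℝ≥0∞} (hb : b ≤ t) : (S.addTime t).ampl 𝔥 (Ioc a b) = 0 := by
  have hsub : (fun s : ℝ≥0∞ => s + (t : ℝ≥0∞)) ⁻¹' Ioc a b ⊆ {0} := by
    intro s hs
    by_contra hs_ne
    exact ((hs.2.trans hb).trans_lt (ENNReal.lt_add_right ENNReal.coe_ne_top hs_ne)).ne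
      (add_comm s t)
  have hproj : (S.addTime t).proj (Ioc a b) = 0 := by
    refine ContinuousLinearMap.ext fun ξ => ?_
    have := S.isProjectionContent_proj.norm_apply_mono
      (measurableSet_Ioc.preimage (by fun_prop)) (measurableSet_singleton _) hsub ξ
    rw [hS, zero_apply, norm_zero] at this
    exact norm_le_zero_iff.1 this
  exact ext_tmul fun u ξ => by
    rw [QuantumStopTime.ampl_tmul, hproj, zero_apply, ← tmulL_apply, map_zero, zero_apply]

theorem projSum_addTime {Z J : ℝ≥0 → Op 𝔥 k} {X : Op 𝔥 k} {S : QuantumStopTime k} {t : ℝ≥0}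
    (hS : S.proj {0} = 0) (hZ : ∀ s, Z (s + t) = J s ∘L ccrFlow s X) {π : Finset ℝ≥0∞}
    (ht : (t : ℝ≥0∞) ∈ π) :
    projSum (extendZero Z) ((S.addTime t).ampl 𝔥) π =
      projSum (fun b => extendZero J b ∘L extendZero (fun s => ccrFlow s X) b) (S.ampl 𝔥)
        (π.image (· - (t : ℝ≥0∞))) := by
  have hZ_sub {b : ℝ≥0∞} (hb : t ≤ b) : extendZero Z b =
      extendZero J (b - t) ∘L extendZero (fun s => ccrFlow s X) (b - t) := by
    obtain ⟨s, rfl⟩ : ∃ s, b = s + t := ⟨b - t, (tsub_add_cancel_of_le hb).symm⟩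
    rw [ENNReal.add_sub_cancel_right ENNReal.coe_ne_top]
    induction s with
    | top => rw [top_add, extendZero_top, extendZero_top, ContinuousLinearMap.zero_comp]
    | coe s => rw [← ENNReal.coe_add, extendZero_coe, extendZero_coe, extendZero_coe, hZ]
  have hsmall {b : ℝ≥0∞}
      (hne : extendZero Z b ∘L (S.addTime t).ampl 𝔥 (Ioc (pred π b) b) ≠ 0) : t < b := by
    by_contra! hb
    exact hne (by rw [ampl_addTime_Ioc_eq_zero hS _ hb, ContinuousLinearMap.comp_zero])
  rw [projSum, projSum, ← Finset.sum_filter_of_ne fun b _ => hsmall]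
  refine Finset.sum_nbij (· - (t : ℝ≥0∞)) (fun b hb => ?_) (fun b hb c hc hbc => ?_)
    (fun b hb => ?_) (fun b hb => ?_)
  · simp only [Finset.mem_filter] at hb ⊢
    exact ⟨Finset.mem_image_of_mem _ hb.1.1, tsub_pos_of_lt hb.2⟩
  · rw [Finset.mem_coe, Finset.mem_filter] at hb hc
    exact (tsub_left_inj hb.2.le hc.2.le).1 hbc
  · obtain ⟨hb_mem, hb_pos⟩ := Finset.mem_filter.1 hb
    obtain ⟨c, hc, rfl⟩ := Finset.mem_image.1 hb_mem
    have htc := tsub_pos_iff_lt.1 hb_pos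
    exact ⟨c, by simpa [hc, htc] using bot_le.trans_lt htc, rfl⟩
  · have htb := (Finset.mem_filter.1 hb).2
    rw [hZ_sub htb.le, ← preimage_add_Ioc_pred ht htb]
    rfl

theorem exists_isStoppedFlow (S : QuantumStopTime k) (X : Op 𝔥 k) :
    ∃ G : Op 𝔥 k, IsStoppedFlow S X (G + S.ampl 𝔥 {∞}) ∧ StrongLim atTop
      (fun π : Partition ∞ => projSum (extendZero fun t => ccrFlow t X) (S.ampl 𝔥) π.1) G := by
  obtain ⟨-, G, -, -, hG⟩ := (isFlowProcess_ccrFlow X).exists_limits_projSum S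
  refine ⟨G, fun x => ?_, hG⟩
  simpa only [riemannSum_ccrFlowExt, add_apply] using (hG x).add (strongLim_ampl_Ioc_pred_top S x)

namespace IsFlowProcess

variable {Z J Y : ℝ≥0 → Op 𝔥 k} {M : ℝ}

theorem exists_isStopped (h : IsFlowProcess Z J Y M) (S : QuantumStopTime k) :
    ∃ W : Op 𝔥 k, IsStopped Z S W ∧
      StrongLim atTop (fun π : Partition ∞ => projSum (extendZero Z) (S.ampl 𝔥) π.1) W := by
  obtain ⟨Wt, W, hWt, hW, hW_top⟩ := h.exists_limits_projSum S
  refine ⟨W, ⟨Wt, fun T _ => ?_, hW⟩, hW_top⟩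
  simpa only [IsStoppedBy, riemannSum_eq_projSum] using hWt T

theorem eq_comp_of_strongLim {J' Y' : ℝ≥0 → Op 𝔥 k} (hJ : IsFlowProcess J J' Y' M)
    {X : Op 𝔥 k} {S : QuantumStopTime k} (hS : S.proj {0} = 0) {t : ℝ≥0}
    (hZ : ∀ s, Z (s + t) = J s ∘L ccrFlow s X) {W H G : Op 𝔥 k}
    (hW : StrongLim atTop
      (fun π : Partition ∞ => projSum (extendZero Z) ((S.addTime t).ampl 𝔥) π.1) W)
    (hH : StrongLim atTop (fun π : Partition ∞ => projSum (extendZero J) (S.ampl 𝔥) π.1) H)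
    (hG : StrongLim atTop
      (fun π : Partition ∞ => projSum (extendZero fun s => ccrFlow s X) (S.ampl 𝔥) π.1) G) :
    W = H ∘L G := by
  have hQ := S.isProjectionContent_ampl 𝔥
  have hHG := StrongLim.comp (fun π : Partition ∞ => (hJ.isOrthoIntegrand S).norm_projSum_le hQ π.1)
    hH hG
  refine hW.unique fun x => ((hHG x).comp (tendsto_shiftPartition t)).congr' ?_
  filter_upwards [eventually_mem_partition (T := (t : ℝ≥0∞)) le_top] with π hπ
  rw [Function.comp_apply, projSum_comp_projSum hQ _
    fun a b => commute_extendZero_ccrFlow_ampl_Iic X S, projSum_addTime hS hZ hπ, shiftPartition]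

end IsFlowProcess

end Stopping

end QStop

end

theorem mainTheorem3_general {𝔥 k : Type*}
    [NormedAddCommGroup 𝔥] [InnerProductSpace ℂ 𝔥] [CompleteSpace 𝔥]
    [NormedAddCommGroup k] [InnerProductSpace ℂ k] [CompleteSpace k]
    (𝒜 : VonNeumannAlgebra 𝔥) (p : k →L[ℂ] k) (hp : IsStarProjection p)
    (S : QStop.QuantumStopTime k) (hS_zero : S.proj {0} = 0)
    (V : QStop.AdaptedProcess 𝒜 p) (hV_cocycle : V.IsCocycle) (hV_isometric : V.IsIsometric)
    (hV_cont : ∀ z, ContinuousAt (fun t => V.op t z) 0) :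
    ∃ VhatS : QStop.Op 𝔥 k,
      QStop.IsStopped V.hat S VhatS ∧
      ∀ t : ℝ≥0, ∃ VSt sigmaSVt : QStop.Op 𝔥 k,
        QStop.IsStopped V.op (S.addTime t) VSt ∧
        QStop.IsStoppedFlow S (V.op t) sigmaSVt ∧
        VSt = VhatS ∘L sigmaSVt := by
  have hhat := hV_cocycle.isFlowProcess_hat hp hV_isometric hV_cont
  have hop := hV_cocycle.isFlowProcess_op hV_isometric hV_cont
  obtain ⟨VhatS, hVhatS, hVhatS_lim⟩ := hhat.exists_isStopped S
  refine ⟨VhatS, hVhatS, fun t => ?_⟩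
  obtain ⟨VSt, hVSt, hVSt_lim⟩ := hop.exists_isStopped (S.addTime t)
  obtain ⟨G, hG, hG_lim⟩ := QStop.exists_isStoppedFlow S (V.op t)
  refine ⟨VSt, G + S.ampl 𝔥 {∞}, hVSt, hG, ?_⟩
  rw [ContinuousLinearMap.comp_add, QStop.comp_ampl_top_of_strongLim hVhatS_lim, add_zero]
  exact hhat.eq_comp_of_strongLim hS_zero (hV_cocycle · t) hVSt_lim hVhatS_lim hG_lim

theorem mainTheorem3 {𝔥 k : Type*}
    [NormedAddCommGroup 𝔥] [InnerProductSpace ℂ 𝔥] [CompleteSpace 𝔥]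
    [NormedAddCommGroup k] [InnerProductSpace ℂ k] [CompleteSpace k]
    (𝒜 : VonNeumannAlgebra 𝔥) (p : k →L[ℂ] k) (hp : IsStarProjection p)
    (S : QStop.QuantumStopTime k) (hS_zero : S.proj {0} = 0) (hS_finite : S.proj {∞} = 0)
    (V : QStop.AdaptedProcess 𝒜 p) (hV_cocycle : V.IsCocycle) (hV_isometric : V.IsIsometric)
    (hV_cont : V.IsStronglyContinuous) :
    ∃ VhatS : QStop.Op 𝔥 k,
      QStop.IsStopped V.hat S VhatS ∧
      ∀ t : ℝ≥0, ∃ VSt sigmaSVt : QStop.Op 𝔥 k,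
        QStop.IsStopped V.op (S.addTime t) VSt ∧
        QStop.IsStoppedFlow S (V.op t) sigmaSVt ∧
        VSt = VhatS ∘L sigmaSVt :=
  mainTheorem3_general 𝒜 p hp S hS_zero V hV_cocycle hV_isometric fun z => (hV_cont z).continuousAt
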